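/- **Parking functions.** Let $n,r\ge 0$ be integers. A Dyck path of size $N$ is a lattice path from $(0,0)$ to $(N,N)$ with unit north and east steps staying weakly above $y=x$. Let $\mathcal{WPF}_{n;r}$ be the set of extended word parking functions: Dyck paths of size $n+r$ whose north steps are labeled by non-negative integers, strictly increasing from bottom to top in each column, with exactly $r$ labels equal to $0$ and with the label of the first (bottom) row nonzero. (The zeros mark the $r$ blank valleys.) For $\mathrm{PF}\in\mathcal{WPF}_{n;r}$ let $\ell_i$ be the label of row $i$ (counted from the bottom), $a_i$ the number of full cells between the path and the diagonal in row $i$, and let $d_i$ be the number of $j>i$ such that either $a_i=a_j$ and $\ell_i<\ell_j$, or $a_i=a_j+1$ and $\ell_i>\ell_j$. Put $\mathrm{area}=\sum_i a_i$, $\mathrm{dinv}=\sum_i d_i$, $x^{\mathrm{PF}}=\prod_{i:\,\ell_i\ne 0}x_{\ell_i}$, $\mathrm{Rise}=\{i\ge 2: a_i=a_{i-1}+1\}$ and $\mathrm{Val}=\{i\ge 2: a_i<a_{i-1}\text{, or } a_i=a_{i-1}\text{ and }\ell_i>\ell_{i-1}\}$. For an integer $k$ let $$\mathrm{Rise}_{r;n,k}[X;q,t]=\sum_{\mathrm{PF}\in\mathcal{WPF}_{n;r}}t^{\mathrm{area}}q^{\mathrm{dinv}}x^{\mathrm{PF}}\prod_{i\in\mathrm{Rise}}\Bigl(1+\frac{z}{t^{a_i}}\Bigr)\Big|_{z^{n-k-1}},$$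 $$\mathrm{Val}_{r;n,k}[X;q,t]=\sum_{\mathrm{PF}\in\mathcal{WPF}_{n;r}}t^{\mathrm{area}}q^{\mathrm{dinv}}x^{\mathrm{PF}}\prod_{i\in\mathrm{Val}}\Bigl(1+\frac{z}{q^{d_i+1}}\Bigr)\Big|_{z^{n-k-1}}$$ (a coefficient of a negative power of $z$ is $0$). These are the combinatorial sides of the rise and valley versions of the Extended Delta Conjecture. **Ordered multiset partitions.** For a weak composition $\beta=(\beta_1,\dots,\beta_\ell)$ (a finite sequence of non-negative integers) and an integer $m$, let $\mathcal{OP}_{r;\beta,m}$ be the set of sequences $\pi=B_1/\cdots/B_m$ of $m$ nonempty sets (blocks) whose multiset union is $\{0^r,1^{\beta_1},\dots,\ell^{\beta_\ell}\}$ and whose last block does not contain $0$ (it is empty if $m<0$). Let $B_i^h$ be the $h$th smallest element of $B_i$. * $\mathrm{inv}(\pi)$ is the number of pairs of entries $a>b$ of $\pi$ such that $b$ is the minimum of its block and $a$ is in a block strictly to the left of $b$'s block. * $\mathrm{dinv}(\pi)$ is the number of triples $(h,i,j)$ with $i<j$ and $B_i^h>B_j^h$, plus the number of triples $(h,i,j)$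 with $i<j$ and $B_i^h<B_j^{h+1}$ (the elements compared being required to exist). * $\mathrm{maj}(\pi)=\sum_{i:\,\sigma_i>\sigma_{i+1}}\mathrm{ind}_{i+1}$, where $\sigma$ is the word obtained by writing $B_1,\dots,B_m$ one after the other, each in decreasing order, and $\mathrm{ind}=0^{|B_1|}1^{|B_2|}\cdots(m-1)^{|B_m|}$. * $\mathrm{minimaj}(\pi)$ is the sum of the descent positions $\{i:w_i>w_{i+1}\}$ of the word $w$ built from right to left as follows: write $B_m$ in increasing order; then, for $i=m-1,\dots,1$, write to the left of the existing word first the elements of $B_i$ strictly bigger than the first letter of the existing word, in increasing order, followed by the remaining elements of $B_i$, in increasing order. For each of these statistics let $D^{\mathrm{stat}}_{r;\beta,m}(q)=\sum_{\pi\in\mathcal{OP}_{r;\beta,m}}q^{\mathrm{stat}(\pi)}$. **Theorem.** Let $n,r\ge 0$ and $k$ be integers, let $\beta=(\beta_1,\dots,\beta_\ell)$ be a weak composition of $n$, and let $|_{M_\beta}$ denote the coefficient of the monomial $x_1^{\beta_1}\cdots x_\ell^{\beta_\ell}$. Then $\mathrm{Rise}_{r;n,k}[X;q,t]|_{M_\beta}$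 and $\mathrm{Val}_{r;n,k}[X;q,t]|_{M_\beta}$ are polynomials in $q$ and $t$ with integer coefficients, and $$\mathrm{Rise}_{r;n,k}[X;q,0]|_{M_\beta}=D^{\mathrm{dinv}}_{r;\beta,k+r+1}(q),\qquad \mathrm{Rise}_{r;n,k}[X;0,q]|_{M_\beta}=D^{\mathrm{maj}}_{r;\beta,k+r+1}(q),$$ $$\mathrm{Val}_{r;n,k}[X;q,0]|_{M_\beta}=D^{\mathrm{inv}}_{r;\beta,k+r+1}(q),\qquad \mathrm{Val}_{r;n,k}[X;0,q]|_{M_\beta}=D^{\mathrm{minimaj}}_{r;\beta,k+r+1}(q).$$ -/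

import Mathlib

open scoped Polynomial
open Finset

namespace ExtendedDelta

noncomputable section

/-! ### Dyck paths and extended word parking functions -/

/-- A Dyck path of size `N`: a lattice path from `(0,0)` to `(N,N)` with unit north and east steps
which stays weakly above the line `y = x`. The path is recorded by the `x`-coordinates `col i` of
its north steps, the rows being numbered `0, …, N - 1` from bottom to top: the north step of row `i`
goes from `(col i, i)` to `(col i, i + 1)`. -/
structure DyckPath (N : ℕ) where
  col : Fin N → ℕ
  mono : Monotone col
  above : ∀ i, col i ≤ (i : ℕ)

/-- An extended word parking function of size `n + r` with `r` blank valleys. North steps are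
labeled, strictly increasingly along columns (from bottom to top); a blank valley is given the
label `0`. A label `0` can occur only at the bottom of a column, and the bottom of a column is
either a valley (a row `i` with `a_i ≤ a_{i-1}`) or the first row, so the requirement that only
valleys are blank says that the first row is not labeled `0`. -/
structure ExtWPF (n r : ℕ) extends DyckPath (n + r) where
  label : Fin (n + r) → ℕ
  column_strict : ∀ i j, i < j → col i = col j → label i < label j
  first_ne_zero : ∀ i : Fin (n + r), (i : ℕ) = 0 → label i ≠ 0
  card_blank : #{i | label i = 0} = r

namespace ExtWPF

variable {n r : ℕ}

/-- `a_i`: the number of full cells between the path and the diagonal in row `i`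
(no truncation occurs, by `above`). -/
def rowArea (PF : ExtWPF n r) (i : Fin (n + r)) : ℕ := (i : ℕ) - PF.col i

/-- `d_i`: the number of dinv pairs `(i, j)` with `i < j`. -/
def rowDinv (PF : ExtWPF n r) (i : Fin (n + r)) : ℕ :=
  #{j | i < j ∧
    ((PF.rowArea i = PF.rowArea j ∧ PF.label i < PF.label j) ∨
      (PF.rowArea i = PF.rowArea j + 1 ∧ PF.label j < PF.label i))}

def area (PF : ExtWPF n r) : ℕ := ∑ i, PF.rowArea i

def dinv (PF : ExtWPF n r) : ℕ := ∑ i, PF.rowDinv i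

/-- The double rises: rows `i` with `a_i = a_{i-1} + 1`. -/
def Rise (PF : ExtWPF n r) : Finset (Fin (n + r)) :=
  {i | ∃ j : Fin (n + r), (j : ℕ) + 1 = i ∧ PF.rowArea i = PF.rowArea j + 1}

/-- The contractible valleys: rows `i` with `a_i < a_{i-1}`, or `a_i = a_{i-1}` and
`ℓ_i > ℓ_{i-1}`. -/
def Val (PF : ExtWPF n r) : Finset (Fin (n + r)) :=
  {i | ∃ j : Fin (n + r), (j : ℕ) + 1 = i ∧
    (PF.rowArea i < PF.rowArea j ∨
      (PF.rowArea i = PF.rowArea j ∧ PF.label j < PF.label i))}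

/-- The exponent of the monomial `x^PF = ∏ x_{ℓ_i}`, the product being over the rows that are not
blank (label `0`). -/
def weight (PF : ExtWPF n r) : ℕ →₀ ℕ :=
  ∑ i with PF.label i ≠ 0, Finsupp.single (PF.label i) 1

theorem finite_weight_eq (n r : ℕ) (m : ℕ →₀ ℕ) : {PF : ExtWPF n r | PF.weight = m}.Finite := by
  have hA : (Set.univ.pi fun _ : Fin (n + r) => Set.Iic (n + r)).Finite :=
    Set.Finite.pi fun _ => Set.finite_Iic _
  have hB : (Set.univ.pi fun _ : Fin (n + r) =>
      ((insert 0 m.support : Finset ℕ) : Set ℕ)).Finite :=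
    Set.Finite.pi fun _ => Finset.finite_toSet _
  refine Set.Finite.of_finite_image (f := fun PF : ExtWPF n r => (PF.col, PF.label))
    ((hA.prod hB).subset ?_) ?_
  · rintro _ ⟨PF, hPF, rfl⟩
    refine ⟨fun i _ => (PF.above i).trans i.2.le, fun i _ => ?_⟩
    by_cases h : PF.label i = 0
    · simp [h]
    · have h1 : Finsupp.single (PF.label i) 1 ≤ PF.weight :=
        Finset.single_le_sum (f := fun i => Finsupp.single (PF.label i) 1)
          (fun _ _ => zero_le) (by simp [h])
      have h2 := h1 (PF.label i)
      rw [hPF] at h2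
      simp only [Finsupp.single_eq_same] at h2
      simp only [Finset.coe_insert, Set.mem_insert_iff, Finset.mem_coe, Finsupp.mem_support_iff]
      right
      omega
  · rintro ⟨⟨_, _, _⟩, _, _, _, _⟩ _ ⟨⟨_, _, _⟩, _, _, _, _⟩ _ h
    simp only [Prod.mk.injEq] at h
    obtain ⟨rfl, rfl⟩ := h
    rfl

end ExtWPF

/-! ### The two combinatorial sides -/

/-- The coefficient field `ℚ(q,t)`, as the fraction field of `ℤ[q,t]`. -/
abbrev Kqt : Type := FractionRing (MvPolynomial (Fin 2) ℤ)

def q : Kqt := algebraMap (MvPolynomial (Fin 2) ℤ) Kqt (MvPolynomial.X 0)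

def t : Kqt := algebraMap (MvPolynomial (Fin 2) ℤ) Kqt (MvPolynomial.X 1)

/-- The formal series `∑ f(PF) x^PF` over all extended word parking functions, a power series in
`x_1, x_2, …` (the variable of index `0` does not occur), defined coefficient by coefficient. -/
def genSeries {n r : ℕ} (f : ExtWPF n r → Kqt) : MvPowerSeries ℕ Kqt :=
  fun m => ∑ PF ∈ (ExtWPF.finite_weight_eq n r m).toFinset, f PF

/-- The coefficient of `z^e` in a polynomial in `z`, for an integer `e` (zero if `e < 0`). -/
def zCoeff (e : ℤ) (p : Kqt[X]) : Kqt := if 0 ≤ e then p.coeff e.toNat else 0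

/-- The combinatorial side of the rise version of the Extended Delta Conjecture:
`∑ t^area q^dinv x^PF ∏_{i ∈ Rise} (1 + z / t^{a_i})`, coefficient of `z^{n-k-1}`. -/
def riseSide (r n : ℕ) (k : ℤ) : MvPowerSeries ℕ Kqt :=
  genSeries fun PF : ExtWPF n r => zCoeff ((n : ℤ) - k - 1)
    (Polynomial.C (t ^ PF.area * q ^ PF.dinv) *
      ∏ i ∈ PF.Rise, (1 + Polynomial.C (1 / t ^ PF.rowArea i) * Polynomial.X))

/-- The combinatorial side of the valley version of the Extended Delta Conjecture:
`∑ t^area q^dinv x^PF ∏_{i ∈ Val} (1 + z / q^{d_i + 1})`, coefficient of `z^{n-k-1}`. -/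
def valSide (r n : ℕ) (k : ℤ) : MvPowerSeries ℕ Kqt :=
  genSeries fun PF : ExtWPF n r => zCoeff ((n : ℤ) - k - 1)
    (Polynomial.C (t ^ PF.area * q ^ PF.dinv) *
      ∏ i ∈ PF.Val, (1 + Polynomial.C (1 / q ^ (PF.rowDinv i + 1)) * Polynomial.X))

/-- The exponent of the monomial `x_1^{β_1} ⋯ x_ℓ^{β_ℓ}`. -/
def monoExp {ℓ : ℕ} (β : Fin ℓ → ℕ) : ℕ →₀ ℕ := ∑ i : Fin ℓ, Finsupp.single ((i : ℕ) + 1) (β i)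

/-! ### Extended ordered multiset partitions -/

/-- The multiset `{0^r, 1^{β_1}, …, ℓ^{β_ℓ}}`. -/
def content (r : ℕ) {ℓ : ℕ} (β : Fin ℓ → ℕ) : Multiset ℕ :=
  Multiset.replicate r 0 + ∑ i : Fin ℓ, Multiset.replicate (β i) ((i : ℕ) + 1)

/-- The ordered multiset partitions `B_1 / ⋯ / B_k` of `{0^r, 1^{β_1}, …, ℓ^{β_ℓ}}` into `k`
blocks (nonempty sets) such that `0` is not contained in the last block. -/
def OP (r : ℕ) {ℓ : ℕ} (β : Fin ℓ → ℕ) (k : ℤ) : Set (List (Finset ℕ)) :=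
  {π | (∀ B ∈ π, B.Nonempty) ∧ (π.map Finset.val).sum = content r β ∧
    (∀ B, π.getLast? = some B → 0 ∉ B) ∧ (π.length : ℤ) = k}

theorem OP_finite (r : ℕ) {ℓ : ℕ} (β : Fin ℓ → ℕ) (k : ℤ) : (OP r β k).Finite := by
  refine ((List.finite_length_eq {B // B ∈ (content r β).toFinset.powerset} k.toNat).image
    (List.map Subtype.val)).subset ?_
  rintro π ⟨-, h2, -, h4⟩
  have h : ∀ B ∈ π, B ∈ (content r β).toFinset.powerset := by
    intro B hB
    rw [Finset.mem_powerset]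
    intro x hx
    rw [Multiset.mem_toFinset, ← h2]
    exact Multiset.mem_of_le (List.le_sum_of_mem (List.mem_map_of_mem hB)) hx
  refine ⟨π.attachWith _ h, ?_, by simp⟩
  simp only [Set.mem_ofPred_eq, List.length_attachWith]
  omega

/-! ### The four statistics -/

/-- The number of pairs `a > b` with `b` the minimum of its block and `a` in a block strictly to
the left of the block of `b`. -/
def inv (π : List (Finset ℕ)) : ℕ :=
  ∑ j : Fin π.length, ∑ i : Fin π.length with i < j,
    #{p ∈ π.get i ×ˢ π.get j | p.2 < p.1 ∧ ∀ c ∈ π.get j, p.2 ≤ c}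

/-- The `(h + 1)`-st smallest element of a block, for `h < #B`. -/
def nthSmallest (B : Finset ℕ) (h : ℕ) : ℕ := (B.sort (· ≤ ·)).getD h 0

/-- The number of primary dinvs (`i < j` and `B_i^h > B_j^h`) plus the number of secondary dinvs
(`i < j` and `B_i^h < B_j^{h+1}`), where the elements compared have to exist. -/
def opDinv (π : List (Finset ℕ)) : ℕ :=
  ∑ j : Fin π.length, ∑ i : Fin π.length with i < j,
    (#{h ∈ range #(π.get i) | h < #(π.get j) ∧
        nthSmallest (π.get j) h < nthSmallest (π.get i) h} +
      #{h ∈ range #(π.get i) | h + 1 < #(π.get j) ∧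
        nthSmallest (π.get i) h < nthSmallest (π.get j) (h + 1)})

/-- The word obtained by writing each block in decreasing order. -/
def sigma (π : List (Finset ℕ)) : List ℕ := π.flatMap fun B => B.sort (· ≥ ·)

/-- The index word `0^{|B_1|} 1^{|B_2|} ⋯ (k-1)^{|B_k|}`. -/
def ind (π : List (Finset ℕ)) : List ℕ :=
  (π.mapIdx fun i B => List.replicate #B i).flatten

/-- The sum of the letters `ind_{i+1}` over the descents `i` of the word `sigma π`. -/
def opMaj (π : List (Finset ℕ)) : ℕ :=
  ∑ i ∈ range ((sigma π).length - 1),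
    if (sigma π).getD (i + 1) 0 < (sigma π).getD i 0 then (ind π).getD (i + 1) 0 else 0

/-- The word built from right to left, each block being written with its elements that are strictly
bigger than the first letter of the next (already written) block first, in increasing order,
followed by its remaining elements in increasing order. -/
def miniword : List (Finset ℕ) → List ℕ
  | [] => []
  | B :: π =>
    match miniword π with
    | [] => B.sort (· ≤ ·)
    | a :: w =>
      ({x ∈ B | a < x} : Finset ℕ).sort (· ≤ ·) ++ ({x ∈ B | x ≤ a} : Finset ℕ).sort (· ≤ ·) ++
        a :: w

/-- The major index of a word: the sum of its descent positions, which are numbered from `1`. -/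
def wordMaj (w : List ℕ) : ℕ :=
  ∑ i ∈ range (w.length - 1), if w.getD (i + 1) 0 < w.getD i 0 then i + 1 else 0

def minimaj (π : List (Finset ℕ)) : ℕ := wordMaj (miniword π)

/-- The generating polynomial of a statistic over the ordered multiset partitions `OP r β k`. -/
def genPoly (r : ℕ) {ℓ : ℕ} (β : Fin ℓ → ℕ) (k : ℤ) (stat : List (Finset ℕ) → ℕ) : ℤ[X] :=
  ∑ π ∈ (OP_finite r β k).toFinset, Polynomial.X ^ stat π

end

end ExtendedDelta

namespace ExtendedDelta

/-! ### Linked lists -/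

/-! Expand the product over `Rise` or `Val`. Each side becomes a sum over parking functions with n -
k - 1 marked rises (resp. contractible valleys), so with k + r + 1 unmarked rows, one for each
block. A factor z/t^{a_i} cancels the area of a marked row, which leaves t^{`uArea`} q^{`listDinv`}.
A factor z/q^{d_i+1} cancels the dinv pairs starting at a marked row and one more, which leaves
t^{`listArea`} q^{`uDinv` - `marks`}. The last exponent is non-negative because every marked valley
is attacked by an unmarked row below it (`Valid.marks_le_uDinv`), so both sides are polynomials.
Setting t or q to 0 keeps the marked parking functions for which one exponent vanishes, and each of
the four claims is a bijection from these to ordered multiset partitions carrying the other exponent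
to the statistic (`sum_marked_eq_genPoly`).

In three cases the vanishing condition forces the area of a row from its label, its mark and the row
below (`Arranged`). Then the parking function is just the word of its marked labels, read from top
to bottom: blocks in decreasing order with only the minima unmarked (`bijOn_arrange`). If the area
is 0, unmarked attackers are block minima, and `inv` appears. If the dinv is 0, there are no
contractible valleys, the area of a row counts the descents of the word from that letter on, and
summing over the minima gives `opMaj`. If the unmarked area is 0, each block is a column starting on
the diagonal, and dinv pairs between columns are the primary and secondary pairs of `opDinv`.

For `minimaj` the condition is `uDinv = marks`: each marked row has exactly one unmarked attacker
and unmarked rows have none. Order rows by `IsVal`: smaller area first, then larger label. Writing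
x⁺ for x raised by one diagonal, `y.Step x` says that y precedes x⁺, and v attacks x exactly when x
precedes v and v precedes x⁺. Let u be the topmost unmarked row. The rows that do not precede u but
precede u⁺ realize every label exactly once (`Window`), so a new block has forced areas; its last
row v becomes the new topmost unmarked row. The block is inserted among the marked rows above u,
just below those that v would otherwise attack in violation of uniqueness: rows T with `¬ v.Step x`
stay on top. This is `Build`. Areas in a window go up exactly at the descents of the minimaj word,
so the total area is `minimaj`. Conversely, tightness of `Valid.marks_le_uDinv` allows the top block
to be removed (`exists_build_eq`). -/

/-- Consecutive elements of `l` are related by `R` and its last element satisfies `P`. -/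
def Linked {α : Type*} (R : α → α → Prop) (P : α → Prop) (l : List α) : Prop :=
  l.IsChain R ∧ ∀ x ∈ l.getLast?, P x

section Linked

variable {α β : Type*} {R : α → α → Prop} {P : α → Prop}

@[simp] theorem linked_nil : Linked R P [] := by simp [Linked]

@[simp] theorem linked_singleton {x : α} : Linked R P [x] ↔ P x := by simp [Linked]

@[simp] theorem linked_cons_cons {x y : α} {l : List α} :
    Linked R P (y :: x :: l) ↔ R y x ∧ Linked R P (x :: l) := by
  simp [Linked, and_assoc]

theorem linked_append_cons {A D : List α} {x : α} :
    Linked R P (A ++ x :: D) ↔ (A ++ [x]).IsChain R ∧ Linked R P (x :: D) := by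
  induction A with
  | nil => simp
  | cons y A ih => cases A with
    | nil => simp
    | cons z A => simp only [List.cons_append] at ih; simp [ih, and_assoc]

theorem Linked.tail {y : α} {l : List α} (h : Linked R P (y :: l)) : Linked R P l := by
  cases l <;> simp_all

theorem Linked.right_of_append {A D : List α} (h : Linked R P (A ++ D)) : Linked R P D := by
  induction A with
  | nil => exact h
  | cons y A ih => exact ih h.tail

theorem Linked.imp {S : α → α → Prop} {Q : α → Prop} {l : List α} (h : Linked R P l)
    (hR : ∀ y x, R y x → S y x) (hP : ∀ x, P x → Q x) : Linked S Q l := by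
  induction l with
  | nil => simp
  | cons y l ih => cases l <;> simp_all

theorem linked_map {f : β → α} {l : List β} :
    Linked R P (l.map f) ↔ Linked (fun y x => R (f y) (f x)) (fun x => P (f x)) l := by
  induction l with
  | nil => simp
  | cons y l ih => cases l <;> simp_all

end Linked

/-! ### Sums over the pairs of entries of a list -/

section PairSum

variable {α β : Type*}

/-- The sum of `g x y` over all pairs of entries `x`, `y` of the list, with `x` before `y`. -/
def pairSum (g : α → α → ℕ) : List α → ℕ
  | [] => 0
  | x :: l => (l.map (g x)).sum + pairSum g l

@[simp] theorem pairSum_nil (g : α → α → ℕ) : pairSum g [] = 0 := rfl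

@[simp] theorem pairSum_cons (g : α → α → ℕ) (x : α) (l : List α) :
    pairSum g (x :: l) = (l.map (g x)).sum + pairSum g l := rfl

/-- The sum of `g x y` over the entries `x` of `A` and `y` of `B`. -/
def crossSum (g : α → α → ℕ) (A B : List α) : ℕ := (A.map fun x => (B.map (g x)).sum).sum

@[simp] theorem crossSum_nil_left (g : α → α → ℕ) (B : List α) : crossSum g [] B = 0 := rfl

@[simp] theorem crossSum_cons_left (g : α → α → ℕ) (x : α) (A B : List α) :
    crossSum g (x :: A) B = (B.map (g x)).sum + crossSum g A B := rfl

@[simp] theorem crossSum_nil_right (g : α → α → ℕ) (A : List α) : crossSum g A [] = 0 := by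
  induction A <;> simp_all

theorem crossSum_append_right (g : α → α → ℕ) (A B D : List α) :
    crossSum g A (B ++ D) = crossSum g A B + crossSum g A D := by
  induction A with
  | nil => simp
  | cons x A ih => simp [ih]; omega

theorem crossSum_cons_right (g : α → α → ℕ) (x : α) (A B : List α) :
    crossSum g A (x :: B) = (A.map fun y => g y x).sum + crossSum g A B := by
  induction A with
  | nil => simp
  | cons y A ih => simp [ih]; omega

theorem pairSum_append (g : α → α → ℕ) (A B : List α) :
    pairSum g (A ++ B) = pairSum g A + pairSum g B + crossSum g A B := by
  induction A with
  | nil => simp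
  | cons x A ih => simp [ih]; omega

theorem pairSum_map (g : β → β → ℕ) (f : α → β) (l : List α) :
    pairSum g (l.map f) = pairSum (fun x y => g (f x) (f y)) l := by
  induction l with
  | nil => rfl
  | cons x l ih => simp [ih, Function.comp_def]

theorem pairSum_reverse (g : α → α → ℕ) (l : List α) :
    pairSum g l.reverse = pairSum (fun x y => g y x) l := by
  induction l with
  | nil => rfl
  | cons x l ih =>
    simp [pairSum_append, crossSum_cons_right, ih, List.map_reverse, List.sum_reverse]; omega

theorem pairSum_flatMap {γ : Type*} (g : γ → γ → ℕ) (f : α → List γ) (l : List α) :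
    pairSum g (l.flatMap f) = pairSum (fun x y => crossSum g (f x) (f y)) l +
      (l.map fun x => pairSum g (f x)).sum := by
  have key : ∀ (A : List γ) (l : List α),
      crossSum g A (l.flatMap f) = (l.map fun y => crossSum g A (f y)).sum := by
    intro A l
    induction l with
    | nil => simp
    | cons x l ih => simp [crossSum_append_right, ih]
  induction l with
  | nil => rfl
  | cons x l ih => simp [pairSum_append, ih, key]; omega

theorem pairSum_ofFn {N : ℕ} (g : α → α → ℕ) (f : Fin N → α) :
    pairSum g (List.ofFn f) = ∑ i, ∑ j with i < j, g (f i) (f j) := by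
  induction N with
  | zero => simp
  | succ N ih =>
    rw [List.ofFn_succ, pairSum_cons, ih, Fin.sum_univ_succ]
    simp [Finset.sum_filter, Fin.sum_univ_succ, List.sum_ofFn, List.map_ofFn]

theorem pairSum_eq_sum_get (g : α → α → ℕ) (l : List α) :
    pairSum g l = ∑ j : Fin l.length, ∑ i : Fin l.length with i < j, g (l.get i) (l.get j) := by
  conv_lhs => rw [← List.ofFn_get l, pairSum_ofFn]
  simp only [Finset.sum_filter]
  exact Finset.sum_comm

end PairSum

/-! ### Marked parking functions as lists of rows -/

/-- A row of a labeled Dyck path: its area, its label, and whether it is marked. -/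
@[ext] structure Row where
  area : ℕ
  label : ℕ
  mark : Bool

/-- `y` may be the row directly above `x`. -/
def Row.Step (y x : Row) : Prop := y.area ≤ x.area + 1 ∧ (y.area = x.area + 1 → x.label < y.label)

/-- The row `y`, directly above `x`, is a double rise. -/
def Row.IsRise (y x : Row) : Prop := y.area = x.area + 1

/-- The row `y`, directly above `x`, is a contractible valley. -/
def Row.IsVal (y x : Row) : Prop := y.area < x.area ∨ (y.area = x.area ∧ x.label < y.label)

/-- `(x, y)` is a dinv pair, if `x` is below `y`. -/
def Row.Att (x y : Row) : Prop :=
  (x.area = y.area ∧ x.label < y.label) ∨ (x.area = y.area + 1 ∧ y.label < x.label)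

instance : DecidableRel Row.Att := fun x y => by unfold Row.Att; infer_instance

instance : DecidableRel Row.IsVal := fun x y => by unfold Row.IsVal; infer_instance

/-- The area of a list of rows. -/
def listArea (V : List Row) : ℕ := (V.map Row.area).sum

/-- The area of the unmarked rows. -/
def uArea (V : List Row) : ℕ := (V.map fun x => if x.mark then 0 else x.area).sum

/-- The number of dinv pairs, the rows being listed from top to bottom. -/
def listDinv (V : List Row) : ℕ := pairSum (fun y x => if x.Att y then 1 else 0) V

/-- The number of dinv pairs whose lower row is unmarked. -/
def uDinv (V : List Row) : ℕ :=
  pairSum (fun y x => if x.mark = false ∧ x.Att y then 1 else 0) V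

/-- The number of marked rows. -/
def marks (V : List Row) : ℕ := V.countP fun x => x.mark

@[simp] theorem listArea_nil : listArea [] = 0 := rfl

@[simp] theorem listArea_cons (x : Row) (V : List Row) :
    listArea (x :: V) = x.area + listArea V := by simp [listArea]

@[simp] theorem uArea_nil : uArea [] = 0 := rfl

@[simp] theorem uArea_cons (x : Row) (V : List Row) :
    uArea (x :: V) = (if x.mark then 0 else x.area) + uArea V := by simp [uArea]

@[simp] theorem marks_nil : marks [] = 0 := rfl

@[simp] theorem marks_cons (x : Row) (V : List Row) :
    marks (x :: V) = marks V + if x.mark then 1 else 0 := by simp [marks, List.countP_cons]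

theorem marks_append (A B : List Row) : marks (A ++ B) = marks A + marks B := by
  simp [marks]

/-- The condition on two consecutive rows of a parking function whose marked rows satisfy `M`. -/
def MarkedStep (M : Row → Row → Prop) (y x : Row) : Prop := y.Step x ∧ (y.mark = true → M y x)

/-- The condition on the first row. -/
def Row.Bottom (x : Row) : Prop := x.area = 0 ∧ x.label ≠ 0 ∧ x.mark = false

/-- The list, from top to bottom, of the rows of a parking function with marked rows in `M`. -/
abbrev Valid (M : Row → Row → Prop) (V : List Row) : Prop := Linked (MarkedStep M) Row.Bottom V

/-- The parking functions with given content, with `m` unmarked rows and with marks in `M`. -/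
def markedSet (M : Row → Row → Prop) (r : ℕ) {ℓ : ℕ} (β : Fin ℓ → ℕ) (m : ℤ) : Set (List Row) :=
  {V | Valid M V ∧ (V.map Row.label : Multiset ℕ) = content r β ∧
    ((V.length : ℤ) - marks V) = m}

/-- Every row that precedes some entry of `V` in the order of `IsVal` is attacked by an entry of
`V` which is not a contractible valley. -/
theorem exists_att {V : List Row} (hV : Linked Row.Step (fun x => x.area = 0) V) {e : Row}
    (h : ∃ x ∈ V, e.IsVal x) :
    ∃ A y D, V = A ++ y :: D ∧ y.Att e ∧ ∀ z ∈ D.head?, ¬ y.IsVal z := by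
  induction V with
  | nil => simp at h
  | cons y V ih =>
    -- The attacker is the lowest row `y` that `e` precedes. The row `z` below `y` is not preceded
    -- by `e`, and `y.Step z` then keeps `y` within one diagonal of `e`. If `y` were a valley over
    -- `z`, transitivity would make `e` precede `z`.
    by_cases h' : ∃ z ∈ V, e.IsVal z
    · obtain ⟨A, w, D, rfl, h1, h2⟩ := ih hV.tail h'
      exact ⟨y :: A, w, D, rfl, h1, h2⟩
    · have hy : e.IsVal y := by
        obtain ⟨x, hx, hex⟩ := h
        rcases List.mem_cons.1 hx with rfl | hx
        · exact hex
        · exact absurd ⟨x, hx, hex⟩ h'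
      refine ⟨[], y, V, rfl, ?_, ?_⟩
      · cases V with
        | nil =>
          simp only [linked_singleton] at hV
          simp only [Row.IsVal, Row.Att] at *
          omega
        | cons z V =>
          have hz : ¬ e.IsVal z := fun hz => h' ⟨z, by simp, hz⟩
          have := (linked_cons_cons.1 hV).1
          simp only [Row.IsVal, Row.Att, Row.Step] at *
          omega
      · intro z hz
        have hz : ¬ e.IsVal z := fun hz' => h' ⟨z, List.mem_of_mem_head? hz, hz'⟩
        simp only [Row.IsVal] at *
        omega

/-! ### The lower bound for the unmarked dinv -/

theorem Valid.step {M : Row → Row → Prop} {V : List Row} (h : Valid M V) :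
    Linked Row.Step (fun x => x.area = 0) V :=
  h.imp (fun _ _ h => h.1) (fun _ h => h.1)

/-- The attacker given by `exists_att` is not a contractible valley, and here only contractible
valleys can be marked. -/
theorem Valid.exists_unmarked_att {V : List Row} (hV : Valid Row.IsVal V) {e : Row}
    (h : ∃ x ∈ V, e.IsVal x) : ∃ y ∈ V, y.mark = false ∧ y.Att e := by
  obtain ⟨A, y, D, rfl, h1, h2⟩ := exists_att hV.step h
  refine ⟨y, by simp, ?_, h1⟩
  have h3 := hV.right_of_append
  cases D with
  | nil => exact (linked_singleton.1 h3).2.2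
  | cons z D =>
    have h4 := (linked_cons_cons.1 h3).1.2
    have h5 := h2 z (by simp)
    by_contra h6
    exact h5 (h4 (by simpa using h6))

/-- The number of unmarked rows of `V` which form a dinv pair with a higher row `y`. -/
def attackers (y : Row) (V : List Row) : ℕ :=
  (V.map fun x => if x.mark = false ∧ x.Att y then 1 else 0).sum

@[simp] theorem uDinv_nil : uDinv [] = 0 := rfl

@[simp] theorem uDinv_cons (y : Row) (V : List Row) :
    uDinv (y :: V) = attackers y V + uDinv V := rfl

theorem attackers_eq_zero {y : Row} {V : List Row} :
    attackers y V = 0 ↔ ∀ x ∈ V, x.mark = false → ¬ x.Att y := by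
  simp [attackers, List.sum_eq_zero_iff]

theorem Valid.attackers_pos {V : List Row} (hV : Valid Row.IsVal V) {e : Row}
    (h : ∃ x ∈ V, e.IsVal x) : 1 ≤ attackers e V := by
  obtain ⟨y, hy, h1, h2⟩ := hV.exists_unmarked_att h
  by_contra h3
  exact attackers_eq_zero.1 (by omega : attackers e V = 0) y hy h1 h2

/-- Each marked row is the upper end of at least one counted pair. Equality is the vanishing
condition at `q = 0` on the valley side. -/
theorem Valid.marks_le_uDinv {V : List Row} (hV : Valid Row.IsVal V) : marks V ≤ uDinv V := by
  induction V with
  | nil => simp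
  | cons y V ih =>
    have h1 := ih hV.tail
    rw [marks_cons, uDinv_cons]
    split_ifs with h
    · cases V with
      | nil => simp [(linked_singleton.1 hV).2.2] at h
      | cons x V =>
        have := Valid.attackers_pos hV.tail ⟨x, by simp, (linked_cons_cons.1 hV).1.2 h⟩
        omega
    · omega

/-! ### The rows of a marked parking function -/

section Rows

variable {n r : ℕ}

/-- The `i`-th row of a parking function with marked rows `S`. -/
def ExtWPF.row (PF : ExtWPF n r) (S : Finset (Fin (n + r))) (i : Fin (n + r)) : Row :=
  ⟨PF.rowArea i, PF.label i, decide (i ∈ S)⟩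

/-- The rows of a parking function with marked rows `S`, from top to bottom. -/
def ExtWPF.rows (PF : ExtWPF n r) (S : Finset (Fin (n + r))) : List Row :=
  (List.ofFn (PF.row S)).reverse

theorem pairSum_rows (PF : ExtWPF n r) (S : Finset (Fin (n + r))) (g : Row → Row → ℕ) :
    pairSum g (PF.rows S) = ∑ i, ∑ j with i < j, g (PF.row S j) (PF.row S i) := by
  rw [ExtWPF.rows, pairSum_reverse, pairSum_ofFn]

theorem sum_map_rows (PF : ExtWPF n r) (S : Finset (Fin (n + r))) (g : Row → ℕ) :
    ((PF.rows S).map g).sum = ∑ i, g (PF.row S i) := by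
  rw [ExtWPF.rows, List.map_reverse, List.sum_reverse, List.map_ofFn, List.sum_ofFn]
  rfl

theorem length_rows (PF : ExtWPF n r) (S : Finset (Fin (n + r))) :
    (PF.rows S).length = n + r := by simp [ExtWPF.rows]

theorem listArea_rows (PF : ExtWPF n r) (S : Finset (Fin (n + r))) :
    listArea (PF.rows S) = PF.area := sum_map_rows PF S _

theorem uArea_rows (PF : ExtWPF n r) (S : Finset (Fin (n + r))) :
    uArea (PF.rows S) + ∑ i ∈ S, PF.rowArea i = PF.area := by
  rw [uArea, sum_map_rows, ExtWPF.area, ← Finset.sum_filter_add_sum_filter_not univ (· ∈ S)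
    PF.rowArea, add_comm]
  congr 1
  · simp
  · simp [ExtWPF.row, Finset.sum_filter]

theorem marks_rows (PF : ExtWPF n r) (S : Finset (Fin (n + r))) : marks (PF.rows S) = #S := by
  have h : ∀ V : List Row, marks V = (V.map fun x => if x.mark then 1 else 0).sum := by
    intro V
    induction V with
    | nil => rfl
    | cons x V ih => simp [ih, add_comm]
  rw [h, sum_map_rows]
  simp [ExtWPF.row]

theorem rowDinv_eq (PF : ExtWPF n r) (S : Finset (Fin (n + r))) (i : Fin (n + r)) :
    PF.rowDinv i = ∑ j with i < j, if (PF.row S i).Att (PF.row S j) then 1 else 0 := by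
  rw [ExtWPF.rowDinv, Finset.card_filter, Finset.sum_filter]
  refine Finset.sum_congr rfl fun j _ => ?_
  by_cases h : i < j
  · simp only [h, true_and, if_true, Row.Att, ExtWPF.row]
    congr
  · simp [h]

theorem listDinv_rows (PF : ExtWPF n r) (S : Finset (Fin (n + r))) :
    listDinv (PF.rows S) = PF.dinv := by
  rw [listDinv, pairSum_rows]
  exact Finset.sum_congr rfl fun i _ => (rowDinv_eq PF S i).symm

theorem uDinv_rows (PF : ExtWPF n r) (S : Finset (Fin (n + r))) :
    uDinv (PF.rows S) + ∑ i ∈ S, PF.rowDinv i = PF.dinv := by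
  rw [uDinv, pairSum_rows, ExtWPF.dinv, ← Finset.sum_filter_add_sum_filter_not univ (· ∈ S)
    PF.rowDinv, add_comm]
  congr 1
  · simp
  · rw [Finset.sum_filter]
    refine Finset.sum_congr rfl fun i _ => ?_
    by_cases h : i ∈ S
    · simp [ExtWPF.row, h]
    · rw [if_pos h, rowDinv_eq PF S i]
      simp [ExtWPF.row, h]

theorem weight_apply (PF : ExtWPF n r) {x : ℕ} (hx : x ≠ 0) :
    PF.weight x = #{i | PF.label i = x} := by
  rw [ExtWPF.weight, Finset.sum_filter, Finsupp.finsetSum_apply, Finset.card_filter]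
  refine Finset.sum_congr rfl fun i _ => ?_
  by_cases h : PF.label i = x
  · simp [h, hx]
  · by_cases h0 : PF.label i = 0 <;> simp [h, h0, hx.symm]

theorem weight_zero (PF : ExtWPF n r) : PF.weight 0 = 0 := by
  rw [ExtWPF.weight, Finset.sum_filter, Finsupp.finsetSum_apply]
  refine Finset.sum_eq_zero fun i _ => ?_
  by_cases h0 : PF.label i = 0 <;> simp [h0]

/-! ### Contents, and recovering a parking function from its rows -/

theorem count_content {ℓ : ℕ} (β : Fin ℓ → ℕ) (x : ℕ) :
    (content r β).count x = (if x = 0 then r else 0) + monoExp β x := by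
  rw [content, Multiset.count_add, Multiset.count_replicate, monoExp, Multiset.count_sum',
    Finsupp.finsetSum_apply]
  congr 1
  · simp [eq_comm]
  · refine Finset.sum_congr rfl fun i _ => ?_
    simp [Multiset.count_replicate, Finsupp.single_apply]

theorem monoExp_zero {ℓ : ℕ} (β : Fin ℓ → ℕ) : monoExp β 0 = 0 := by
  simp [monoExp, Finsupp.finsetSum_apply]

theorem card_content {ℓ : ℕ} (β : Fin ℓ → ℕ) : (content r β).card = r + ∑ i, β i := by
  simp [content]

theorem count_label_rows (PF : ExtWPF n r) (S : Finset (Fin (n + r))) (x : ℕ) :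
    ((PF.rows S).map Row.label).count x = #{i | PF.label i = x} := by
  rw [ExtWPF.rows, List.map_reverse, List.count_reverse, List.map_ofFn, Finset.card_filter,
    List.count_eq_countP]
  have : ∀ {N : ℕ} (f : Fin N → ℕ), (List.ofFn f).countP (· == x) =
      ∑ i, if f i = x then 1 else 0 := by
    intro N f
    induction N with
    | zero => simp
    | succ N ih => rw [List.ofFn_succ, List.countP_cons, ih, Fin.sum_univ_succ, add_comm]; simp
  exact this _

theorem labels_rows_iff {ℓ : ℕ} (β : Fin ℓ → ℕ) (PF : ExtWPF n r) (S : Finset (Fin (n + r))) :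
    ((PF.rows S).map Row.label : Multiset ℕ) = content r β ↔ PF.weight = monoExp β := by
  rw [Multiset.ext, DFunLike.ext_iff]
  refine forall_congr' fun x => ?_
  rw [Multiset.coe_count, count_label_rows, count_content]
  rcases eq_or_ne x 0 with rfl | hx
  · simp [PF.card_blank, weight_zero, monoExp_zero]
  · simp [hx, weight_apply PF hx]

theorem rowArea_add_col (PF : ExtWPF n r) (i : Fin (n + r)) : PF.rowArea i + PF.col i = i := by
  have := PF.above i
  simp only [ExtWPF.rowArea]; omega

theorem linked_reverse_ofFn {α : Type*} {R : α → α → Prop} {P : α → Prop} {N : ℕ}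
    (f : Fin N → α) : Linked R P (List.ofFn f).reverse ↔
      (∀ i j : Fin N, (j : ℕ) + 1 = i → R (f i) (f j)) ∧ ∀ i : Fin N, (i : ℕ) = 0 → P (f i) := by
  rw [Linked, List.isChain_reverse, List.isChain_ofFn, List.getLast?_reverse]
  refine and_congr ⟨fun h i j hij => ?_, fun h i hi => h _ _ rfl⟩ ?_
  · obtain ⟨i, hi⟩ := i
    obtain ⟨j, hj⟩ := j
    obtain rfl : j + 1 = i := hij
    exact h j hi
  · cases N with
    | zero => simp
    | succ N =>
      rw [List.ofFn_succ]
      simp only [List.head?_cons, Option.mem_some_iff, forall_eq']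
      refine ⟨fun h i hi => ?_, fun h => h 0 rfl⟩
      rwa [show i = 0 from Fin.ext hi]

theorem valid_rows {M : Row → Row → Prop} (PF : ExtWPF n r) {S : Finset (Fin (n + r))}
    (hS : ∀ i ∈ S, ∃ j : Fin (n + r), (j : ℕ) + 1 = i ∧ M (PF.row S i) (PF.row S j)) :
    Valid M (PF.rows S) := by
  refine (linked_reverse_ofFn _).2 ⟨fun i j hij => ⟨⟨?_, fun h => ?_⟩, fun h => ?_⟩,
    fun i hi => ⟨?_, PF.first_ne_zero i hi, ?_⟩⟩
  · have h1 := rowArea_add_col PF i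
    have h2 := rowArea_add_col PF j
    have h3 : PF.col j ≤ PF.col i := PF.mono (Fin.le_def.2 (by omega))
    simp only [ExtWPF.row]
    omega
  · have h1 := rowArea_add_col PF i
    have h2 := rowArea_add_col PF j
    simp only [ExtWPF.row] at h
    exact PF.column_strict j i (Fin.lt_def.2 (by omega)) (by omega)
  · obtain ⟨j', hj', h'⟩ := hS i (by simpa [ExtWPF.row] using h)
    rwa [show j = j' from Fin.ext (by omega)]
  · have h1 := rowArea_add_col PF i
    simp only [ExtWPF.row]; omega
  · by_contra h
    obtain ⟨j', hj', h'⟩ := hS i (by simpa [ExtWPF.row] using h)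
    omega

theorem rows_injective :
    Function.Injective fun p : ExtWPF n r × Finset (Fin (n + r)) => p.1.rows p.2 := by
  rintro ⟨PF, S⟩ ⟨PF', S'⟩ h
  have h1 : PF.row S = PF'.row S' := List.ofFn_injective (List.reverse_injective h)
  have h2 : PF.col = PF'.col := by
    funext i
    have h3 := congrArg Row.area (congrFun h1 i)
    have h4 := rowArea_add_col PF i
    have h5 := rowArea_add_col PF' i
    simp only [ExtWPF.row] at h3
    omega
  have h6 : PF.label = PF'.label := funext fun i => congrArg Row.label (congrFun h1 i)
  have h7 : S = S' := by
    ext i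
    simpa [ExtWPF.row] using congrArg Row.mark (congrFun h1 i)
  obtain ⟨⟨_, _, _⟩, _, _, _, _⟩ := PF
  obtain ⟨⟨_, _, _⟩, _, _, _, _⟩ := PF'
  simp only at h2 h6
  subst h2 h6 h7
  rfl

/-- Row `i` must start in column `i - area`; the `Step` conditions say that these columns form a
Dyck path with increasing column labels. -/
theorem exists_rows_eq {M : Row → Row → Prop} {ℓ : ℕ} {β : Fin ℓ → ℕ} (hβ : ∑ i, β i = n)
    {V : List Row} (hV : Valid M V) (hc : (V.map Row.label : Multiset ℕ) = content r β) :
    ∃ (PF : ExtWPF n r) (S : Finset (Fin (n + r))), PF.rows S = V ∧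
      ∀ i ∈ S, ∃ j : Fin (n + r), (j : ℕ) + 1 = i ∧ M (PF.row S i) (PF.row S j) := by
  have hlen : V.length = n + r := by
    have := congrArg Multiset.card hc
    rw [card_content, hβ] at this
    simpa [add_comm] using this
  obtain ⟨f, rfl⟩ : ∃ f : Fin (n + r) → Row, V = (List.ofFn f).reverse := by
    refine ⟨fun i => V.reverse.get (Fin.cast (by simp [hlen]) i), ?_⟩
    rw [eq_comm, List.reverse_eq_iff]
    refine List.ext_getElem (by simp [hlen]) (by simp)
  rw [Valid, linked_reverse_ofFn] at hV
  obtain ⟨h1, h2⟩ := hV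
  -- Areas grow by at most one from 0, so the truncated subtraction defining the columns is exact.
  have harea : ∀ k (hk : k < n + r), (f ⟨k, hk⟩).area ≤ k := by
    intro k
    induction k with
    | zero => intro hk; exact (h2 ⟨0, hk⟩ rfl).1.le
    | succ k ih =>
      intro hk
      have h3 := ih (by omega)
      have h4 := (h1 ⟨k + 1, hk⟩ ⟨k, by omega⟩ rfl).1.1
      omega
  have hmono : Monotone fun i : Fin (n + r) => (i : ℕ) - (f i).area := by
    have : ∀ d i (hi : i + d < n + r),
        i - (f ⟨i, by omega⟩).area ≤ i + d - (f ⟨i + d, hi⟩).area := by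
      intro d
      induction d with
      | zero => intro i hi; exact le_rfl
      | succ d ih =>
        intro i hi
        have h3 := ih i (by omega)
        have h4 := (h1 ⟨i + (d + 1), hi⟩ ⟨i + d, by omega⟩ rfl).1.1
        have h5 := harea (i + d) (by omega)
        omega
    rintro ⟨i, hi⟩ ⟨j, hj⟩ hij
    obtain ⟨d, rfl⟩ := Nat.exists_eq_add_of_le (Fin.mk_le_mk.1 hij)
    exact this d i hj
  -- By monotonicity all rows between two rows of one column lie in that column, so each is a double
  -- rise over its predecessor and the labels increase step by step.
  have hcol : ∀ i j : Fin (n + r), i < j → (i : ℕ) - (f i).area = (j : ℕ) - (f j).area →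
      (f i).label < (f j).label := by
    have : ∀ d i (hi : i + d + 1 < n + r),
        i - (f ⟨i, by omega⟩).area = i + d + 1 - (f ⟨i + d + 1, hi⟩).area →
        (f ⟨i, by omega⟩).label < (f ⟨i + d + 1, hi⟩).label := by
      intro d
      induction d with
      | zero =>
        intro i hi h
        have h5 := harea i (by omega)
        have h6 := harea (i + 1) hi
        exact (h1 ⟨i + 1, hi⟩ ⟨i, by omega⟩ rfl).1.2 (by simp only [add_zero] at h ⊢; omega)
      | succ d ih =>
        intro i hi h
        have h3 : (⟨i, by omega⟩ : Fin (n + r)) ≤ ⟨i + d + 1, by omega⟩ :=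
          Fin.mk_le_mk.2 (by omega)
        have h4 : (⟨i + d + 1, by omega⟩ : Fin (n + r)) ≤ ⟨i + (d + 1) + 1, hi⟩ :=
          Fin.mk_le_mk.2 (by omega)
        have h3 := hmono h3
        have h4 := hmono h4
        simp only at h3 h4
        have h5 := harea (i + d + 1) (by omega)
        have h6 := harea (i + (d + 1) + 1) hi
        refine (ih i (by omega) (by omega)).trans
          ((h1 ⟨i + (d + 1) + 1, hi⟩ ⟨i + d + 1, by omega⟩ rfl).1.2 ?_)
        omega
    rintro ⟨i, hi⟩ ⟨j, hj⟩ hij h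
    obtain ⟨d, rfl⟩ := Nat.exists_eq_add_of_lt (Fin.mk_lt_mk.1 hij)
    exact this d i hj h
  have hblank : #{i | (f i).label = 0} = r := by
    have h3 := congrArg (Multiset.count 0) hc
    rw [count_content, Multiset.coe_count, List.map_reverse, List.count_reverse, List.map_ofFn,
      monoExp_zero] at h3
    rw [if_pos rfl, add_zero] at h3
    conv_rhs => rw [← h3]
    rw [← Multiset.coe_count, ← Fin.univ_val_map, Multiset.count_map, Finset.card_def,
      Finset.filter_val]
    simp [eq_comm]
  let PF : ExtWPF n r :=
    { col := fun i => i - (f i).area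
      mono := hmono
      above := fun i => Nat.sub_le _ _
      label := fun i => (f i).label
      column_strict := hcol
      first_ne_zero := fun i hi => (h2 i hi).2.1
      card_blank := hblank }
  have hrow : PF.row {i | (f i).mark = true} = f := by
    funext i
    have h3 : (i : ℕ) - (i - (f i).area) = (f i).area := by
      have := harea i i.2
      simp only [Fin.eta] at this
      omega
    refine Row.ext h3 rfl ?_
    simp [ExtWPF.row]
  refine ⟨PF, ({i | (f i).mark = true} : Finset (Fin (n + r))), by rw [ExtWPF.rows, hrow],
    fun i hi => ?_⟩
  rw [hrow]
  have hi : (f i).mark = true := by simpa using hi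
  have hi0 : (i : ℕ) ≠ 0 := fun h => by simp [(h2 i h).2.2] at hi
  have hij : ((⟨i - 1, by omega⟩ : Fin (n + r)) : ℕ) + 1 = i := by simp only; omega
  exact ⟨_, hij, (h1 i _ hij).2 hi⟩

end Rows

open scoped Classical in
/-- A bijection between ordered multiset partitions and marked parking functions. -/
theorem sum_marked_eq {n r : ℕ} {k : ℤ} {ℓ : ℕ} {β : Fin ℓ → ℕ} (hβ : ∑ i, β i = n)
    {M : Row → Row → Prop} {R : ExtWPF n r → Finset (Fin (n + r))}
    (hR : ∀ PF S i, i ∈ R PF ↔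
      ∃ j : Fin (n + r), (j : ℕ) + 1 = i ∧ M (PF.row S i) (PF.row S j))
    {p : List Row → Prop} {Φ : List (Finset ℕ) → List Row}
    (hΦ : Set.BijOn Φ (OP r β (k + r + 1)) {V ∈ markedSet M r β (k + r + 1) | p V})
    {A : Type*} [AddCommMonoid A] (F : List Row → A) :
    ∑ PF ∈ (ExtWPF.finite_weight_eq n r (monoExp β)).toFinset,
      ∑ S ∈ (R PF).powerset with (#S : ℤ) = n - k - 1,
        (if p (PF.rows S) then F (PF.rows S) else 0) =
      ∑ π ∈ (OP_finite r β (k + r + 1)).toFinset, F (Φ π) := by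
  -- Both sides are sums of `F` over an image, of `D` under `rows` and of the partitions under `Φ`.
  -- Both maps are injective, so it is enough that the images agree.
  let D : Finset (ExtWPF n r × Finset (Fin (n + r))) :=
    {x ∈ (ExtWPF.finite_weight_eq n r (monoExp β)).toFinset ×ˢ univ |
      x.2 ⊆ R x.1 ∧ (#x.2 : ℤ) = n - k - 1}
  rw [← Finset.sum_finset_product' D _ _
    (f := fun PF S => if p (PF.rows S) then F (PF.rows S) else 0)
    (by simp [D]), ← Finset.sum_filter]
  refine (Finset.sum_image (f := F) (g := fun x : ExtWPF n r × Finset (Fin (n + r)) =>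
    x.1.rows x.2) rows_injective.injOn).symm.trans ?_
  refine Eq.trans ?_ (Finset.sum_image (f := F) (g := Φ) (by simpa using hΦ.injOn))
  congr 1
  rw [← Finset.coe_inj, Finset.coe_image, Finset.coe_image, Set.Finite.coe_toFinset, hΦ.image_eq]
  ext V
  simp only [Set.mem_image, Finset.mem_coe, Finset.mem_filter, D, Finset.mem_product,
    Set.Finite.mem_toFinset, Set.mem_ofPred_eq, Finset.mem_univ, and_true, Prod.exists]
  constructor
  · rintro ⟨PF, S, ⟨⟨h1, h2, h3⟩, h4⟩, rfl⟩
    refine ⟨⟨valid_rows PF fun i hi => (hR PF S i).1 (h2 hi),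
      (labels_rows_iff β PF S).2 h1, ?_⟩, h4⟩
    -- Of `n + r` rows, `n - k - 1` are marked, which leaves `k + r + 1`.
    rw [length_rows, marks_rows, h3]
    push_cast
    ring
  · rintro ⟨⟨h1, h2, h3⟩, h4⟩
    obtain ⟨PF, S, rfl, hS⟩ := exists_rows_eq hβ h1 h2
    refine ⟨PF, S, ⟨⟨(labels_rows_iff β PF S).1 h2, fun i hi => (hR PF S i).2 (hS i hi), ?_⟩, h4⟩,
      rfl⟩
    rw [length_rows, marks_rows] at h3
    push_cast at h3
    linarith

/-- The coefficient of `z^e` in a product of factors `1 + c_i z`. -/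
theorem zCoeff_prod {ι : Type*} (e : ℤ) (a : Kqt) (s : Finset ι) (c : ι → Kqt) :
    zCoeff e (Polynomial.C a * ∏ i ∈ s, (1 + Polynomial.C (c i) * Polynomial.X)) =
      ∑ S ∈ s.powerset with (#S : ℤ) = e, a * ∏ i ∈ S, c i := by
  rw [zCoeff, Finset.prod_one_add]
  simp only [Finset.prod_mul_distrib, Finset.prod_const, ← map_prod]
  split_ifs with h
  · rw [Polynomial.coeff_C_mul, Polynomial.finsetSum_coeff, Finset.mul_sum, Finset.sum_filter]
    refine Finset.sum_congr rfl fun S _ => ?_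
    rw [Polynomial.coeff_C_mul, Polynomial.coeff_X_pow]
    have : (e.toNat = #S) ↔ ((#S : ℤ) = e) := by omega
    simp [this]
  · rw [Finset.filter_false_of_mem fun S _ => by omega, Finset.sum_empty]

/-! ### Specializations of the two combinatorial sides -/

theorem q_ne_zero : q ≠ 0 := by
  rw [q, Ne, IsFractionRing.to_map_eq_zero_iff]
  exact MvPolynomial.X_ne_zero _

theorem t_ne_zero : t ≠ 0 := by
  rw [t, Ne, IsFractionRing.to_map_eq_zero_iff]
  exact MvPolynomial.X_ne_zero _

theorem mem_Rise {n r : ℕ} (PF : ExtWPF n r) (S : Finset (Fin (n + r))) (i : Fin (n + r)) :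
    i ∈ PF.Rise ↔
      ∃ j : Fin (n + r), (j : ℕ) + 1 = i ∧ Row.IsRise (PF.row S i) (PF.row S j) := by
  simp [ExtWPF.Rise, Row.IsRise, ExtWPF.row]

theorem mem_Val {n r : ℕ} (PF : ExtWPF n r) (S : Finset (Fin (n + r))) (i : Fin (n + r)) :
    i ∈ PF.Val ↔
      ∃ j : Fin (n + r), (j : ℕ) + 1 = i ∧ Row.IsVal (PF.row S i) (PF.row S j) := by
  simp [ExtWPF.Val, Row.IsVal, ExtWPF.row]

theorem marks_le_uDinv_rows {n r : ℕ} (PF : ExtWPF n r) {S : Finset (Fin (n + r))}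
    (hS : S ⊆ PF.Val) : #S ≤ uDinv (PF.rows S) := by
  rw [← marks_rows PF S]
  exact (valid_rows PF fun i hi => (mem_Val PF S i).1 (hS hi)).marks_le_uDinv

/-- A sum of powers of `t` and `q` attached to the marked parking functions, as a polynomial. -/
noncomputable def markedPoly {n r : ℕ} (R : ExtWPF n r → Finset (Fin (n + r))) (k : ℤ)
    (m : ℕ →₀ ℕ) (f g : List Row → ℕ) : MvPolynomial (Fin 2) ℤ :=
  ∑ PF ∈ (ExtWPF.finite_weight_eq n r m).toFinset,
    ∑ S ∈ (R PF).powerset with (#S : ℤ) = n - k - 1,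
      MvPolynomial.X 1 ^ f (PF.rows S) * MvPolynomial.X 0 ^ g (PF.rows S)

theorem map_markedPoly {n r : ℕ} (R : ExtWPF n r → Finset (Fin (n + r))) (k : ℤ)
    (m : ℕ →₀ ℕ) (f g : List Row → ℕ) :
    algebraMap (MvPolynomial (Fin 2) ℤ) Kqt (markedPoly R k m f g) =
      ∑ PF ∈ (ExtWPF.finite_weight_eq n r m).toFinset,
        ∑ S ∈ (R PF).powerset with (#S : ℤ) = n - k - 1,
          t ^ f (PF.rows S) * q ^ g (PF.rows S) := by
  simp only [markedPoly, map_sum, map_mul, map_pow, t, q]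

/-- The choice of `z / t ^ a_i` on `S` removes from `t ^ area` the areas of the rows in `S`. -/
theorem coeff_riseSide (n r : ℕ) (k : ℤ) (m : ℕ →₀ ℕ) :
    MvPowerSeries.coeff m (riseSide r n k) =
      algebraMap (MvPolynomial (Fin 2) ℤ) Kqt
        (markedPoly (ExtWPF.Rise (n := n) (r := r)) k m uArea listDinv) := by
  rw [map_markedPoly]
  refine Finset.sum_congr rfl fun PF _ => ?_
  refine (zCoeff_prod _ _ _ _).trans ?_
  refine Finset.sum_congr rfl fun S _ => ?_
  rw [listDinv_rows, ← uArea_rows PF S, pow_add, ← Finset.prod_pow_eq_pow_sum]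
  simp only [one_div, Finset.prod_inv_distrib]
  have : ∏ i ∈ S, t ^ PF.rowArea i ≠ 0 := Finset.prod_ne_zero_iff.2 fun _ _ =>
    pow_ne_zero _ t_ne_zero
  field_simp

/-- The choice of `z / q ^ (d_i + 1)` on `S` removes the dinv of the marked rows and one unit per
mark. The truncated subtraction in the exponent is exact by `marks_le_uDinv_rows`. -/
theorem coeff_valSide (n r : ℕ) (k : ℤ) (m : ℕ →₀ ℕ) :
    MvPowerSeries.coeff m (valSide r n k) =
      algebraMap (MvPolynomial (Fin 2) ℤ) Kqt
        (markedPoly (ExtWPF.Val (n := n) (r := r)) k m listArea fun V => uDinv V - marks V) := by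
  rw [map_markedPoly]
  refine Finset.sum_congr rfl fun PF _ => ?_
  refine (zCoeff_prod _ _ _ _).trans ?_
  refine Finset.sum_congr rfl fun S hS => ?_
  have h1 : #S ≤ uDinv (PF.rows S) :=
    marks_le_uDinv_rows PF (Finset.mem_powerset.1 (Finset.mem_filter.1 hS).1)
  have h2 : PF.dinv = uDinv (PF.rows S) - #S + ∑ i ∈ S, (PF.rowDinv i + 1) := by
    rw [← uDinv_rows PF S, Finset.sum_add_distrib, Finset.sum_const]
    simp only [smul_eq_mul, mul_one]
    omega
  rw [listArea_rows, marks_rows, h2, pow_add, ← Finset.prod_pow_eq_pow_sum]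
  simp only [one_div, Finset.prod_inv_distrib]
  have : ∏ i ∈ S, q ^ (PF.rowDinv i + 1) ≠ 0 := Finset.prod_ne_zero_iff.2 fun _ _ =>
    pow_ne_zero _ q_ne_zero
  field_simp

/-- Since `0 ^ 0 = 1`, the value at `t = 0` keeps exactly the terms whose exponent of `t` vanishes.
-/
theorem aeval_X_zero_markedPoly {n r : ℕ} (R : ExtWPF n r → Finset (Fin (n + r))) (k : ℤ)
    (m : ℕ →₀ ℕ) (f g : List Row → ℕ) :
    MvPolynomial.aeval ![(Polynomial.X : ℤ[X]), 0] (markedPoly R k m f g) =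
      ∑ PF ∈ (ExtWPF.finite_weight_eq n r m).toFinset,
        ∑ S ∈ (R PF).powerset with (#S : ℤ) = n - k - 1,
          if f (PF.rows S) = 0 then Polynomial.X ^ g (PF.rows S) else 0 := by
  simp [markedPoly, map_sum, map_mul, map_pow, zero_pow_eq]

theorem aeval_zero_X_markedPoly {n r : ℕ} (R : ExtWPF n r → Finset (Fin (n + r))) (k : ℤ)
    (m : ℕ →₀ ℕ) (f g : List Row → ℕ) :
    MvPolynomial.aeval ![0, (Polynomial.X : ℤ[X])] (markedPoly R k m f g) =
      ∑ PF ∈ (ExtWPF.finite_weight_eq n r m).toFinset,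
        ∑ S ∈ (R PF).powerset with (#S : ℤ) = n - k - 1,
          if g (PF.rows S) = 0 then Polynomial.X ^ f (PF.rows S) else 0 := by
  simp [markedPoly, map_sum, map_mul, map_pow, zero_pow_eq]

theorem sum_marked_eq_genPoly {n r : ℕ} {k : ℤ} {ℓ : ℕ} {β : Fin ℓ → ℕ} (hβ : ∑ i, β i = n)
    {M : Row → Row → Prop} {R : ExtWPF n r → Finset (Fin (n + r))}
    (hR : ∀ PF S i, i ∈ R PF ↔
      ∃ j : Fin (n + r), (j : ℕ) + 1 = i ∧ M (PF.row S i) (PF.row S j))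
    {f g : List Row → ℕ} {stat : List (Finset ℕ) → ℕ} {Φ : List (Finset ℕ) → List Row}
    (hΦ : Set.BijOn Φ (OP r β (k + r + 1)) {V ∈ markedSet M r β (k + r + 1) | f V = 0})
    (hstat : ∀ π ∈ OP r β (k + r + 1), g (Φ π) = stat π) :
    ∑ PF ∈ (ExtWPF.finite_weight_eq n r (monoExp β)).toFinset,
      ∑ S ∈ (R PF).powerset with (#S : ℤ) = n - k - 1,
        (if f (PF.rows S) = 0 then (Polynomial.X : ℤ[X]) ^ g (PF.rows S) else 0) =
      genPoly r β (k + r + 1) stat := by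
  have := sum_marked_eq (k := k) hβ hR hΦ fun V => (Polynomial.X : ℤ[X]) ^ g V
  rw [genPoly]
  refine Eq.trans ?_ (this.trans
    (Finset.sum_congr rfl fun π hπ => by rw [hstat π (by simpa using hπ)]))
  refine Finset.sum_congr rfl fun PF _ => Finset.sum_congr rfl fun S _ => ?_
  congr

/-! ### Marked words -/

theorem linked_cons {α : Type*} {R : α → α → Prop} {P : α → Prop} {y : α} {l : List α} :
    Linked R P (y :: l) ↔ (∀ x ∈ l.head?, R y x) ∧ (l = [] → P y) ∧ Linked R P l := by
  cases l <;> simp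

/-- The entries of a block in decreasing order, all but the smallest one being marked. -/
def blockWord (B : Finset ℕ) : List (ℕ × Bool) :=
  (B.sort (· ≥ ·)).map fun x => (x, decide (∃ y ∈ B, y < x))

/-- The word `sigma π`, all letters but the minima of the blocks being marked. -/
def blocksWord (π : List (Finset ℕ)) : List (ℕ × Bool) := π.flatMap blockWord

@[simp] theorem blockWord_singleton (x : ℕ) : blockWord {x} = [(x, false)] := by
  simp [blockWord]

theorem blockWord_insert {B : Finset ℕ} (hB : B.Nonempty) {x : ℕ} (hx : ∀ b ∈ B, b < x) :
    blockWord (insert x B) = (x, true) :: blockWord B := by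
  rw [blockWord, Finset.sort_insert _ (fun b hb => (hx b hb).le) (fun h => (hx x h).false),
    List.map_cons]
  obtain ⟨b, hb⟩ := hB
  congr 1
  · simp only [Finset.mem_insert, Prod.mk.injEq, decide_eq_true_eq, true_and]
    exact ⟨b, Or.inr hb, hx b hb⟩
  · refine List.map_congr_left fun y hy => ?_
    have hy : y ∈ B := by simpa using hy
    have : ¬ x < y := by have := hx y hy; omega
    simp [this]

-- Blocks grow by a new maximum, which is the new first, marked letter of `blockWord`.
@[elab_as_elim]
theorem block_induction {P : ∀ B : Finset ℕ, B.Nonempty → Prop}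
    (h1 : ∀ x, P {x} (Finset.singleton_nonempty x))
    (h2 : ∀ x B (hB : B.Nonempty), (∀ b ∈ B, b < x) → P B hB →
      P (insert x B) (Finset.insert_nonempty x B)) (B : Finset ℕ) (hB : B.Nonempty) : P B hB := by
  induction B using Finset.induction_on_max with
  | empty => simp at hB
  | insert x B hx ih =>
    rcases B.eq_empty_or_nonempty with rfl | h
    · exact h1 x
    · exact h2 x B h hx (ih h)

/-- The ordered set partition with a given marked word. -/
def decodeWord : List (ℕ × Bool) → List (Finset ℕ)
  | [] => []
  | (x, false) :: w => {x} :: decodeWord w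
  | (x, true) :: w =>
    match decodeWord w with
    -- Default value, not met on words of partitions, which end with an unmarked letter.
    | [] => []
    | B :: π => insert x B :: π

theorem decodeWord_append {B : Finset ℕ} (hB : B.Nonempty) (w : List (ℕ × Bool)) :
    decodeWord (blockWord B ++ w) = B :: decodeWord w := by
  induction B, hB using block_induction with
  | h1 x => simp [decodeWord]
  | h2 x B hB hx ih => rw [blockWord_insert hB hx, List.cons_append, decodeWord, ih]

theorem decodeWord_blocksWord {π : List (Finset ℕ)} (hπ : ∀ B ∈ π, B.Nonempty) :
    decodeWord (blocksWord π) = π := by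
  induction π with
  | nil => rfl
  | cons B π ih =>
    rw [blocksWord, List.flatMap_cons, decodeWord_append (hπ B (by simp))]
    exact congrArg _ (ih fun C hC => hπ C (by simp [hC]))

/-- The words of ordered multiset partitions whose last block does not contain `0`. -/
abbrev ValidWord (w : List (ℕ × Bool)) : Prop :=
  Linked (fun y x => y.2 = true → x.1 < y.1) (fun x => x.1 ≠ 0 ∧ x.2 = false) w

theorem blockWord_ne_nil {B : Finset ℕ} (hB : B.Nonempty) : blockWord B ≠ [] := by
  intro h
  have h1 := congrArg List.length h
  simp [blockWord, hB.ne_empty] at h1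

theorem validWord_append {B : Finset ℕ} (hB : B.Nonempty) {w : List (ℕ × Bool)}
    (hw : ValidWord w) (h0 : w = [] → 0 ∉ B) : ValidWord (blockWord B ++ w) := by
  induction B, hB using block_induction with
  | h1 x =>
    rw [blockWord_singleton, List.singleton_append]
    refine linked_cons.2 ⟨by simp, fun h => ⟨fun hx => h0 h ?_, rfl⟩, hw⟩
    exact Finset.mem_singleton.2 hx.symm
  | h2 x B hB hx ih =>
    rw [blockWord_insert hB hx, List.cons_append]
    refine linked_cons.2 ⟨?_, fun h => ?_, ih fun h => fun h' => h0 h (by simp [h'])⟩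
    · rintro ⟨z, m⟩ hz -
      rw [List.head?_append_of_ne_nil _ (blockWord_ne_nil hB)] at hz
      have := List.mem_of_mem_head? hz
      simp only [blockWord, List.mem_map, Finset.mem_sort, Prod.mk.injEq] at this
      obtain ⟨z', h1, rfl, -⟩ := this
      exact hx _ h1
    · exact absurd (List.append_eq_nil_iff.1 h).1 (blockWord_ne_nil hB)

theorem validWord_blocksWord {π : List (Finset ℕ)} (hπ : ∀ B ∈ π, B.Nonempty)
    (h0 : ∀ B, π.getLast? = some B → 0 ∉ B) : ValidWord (blocksWord π) := by
  induction π with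
  | nil => exact linked_nil
  | cons B π ih =>
    rw [blocksWord, List.flatMap_cons]
    cases π with
    | nil => exact validWord_append (hπ B (by simp)) linked_nil fun _ => h0 B rfl
    | cons C π =>
      refine validWord_append (hπ B (by simp)) (ih (fun D hD => hπ D (by simp_all)) ?_) fun h => ?_
      · intro D hD
        exact h0 D (by rw [List.getLast?_cons_cons, hD])
      · rw [List.flatMap_cons] at h
        exact absurd (List.append_eq_nil_iff.1 h).1 (blockWord_ne_nil (hπ C (by simp)))

/-- Read from right to left, an unmarked letter opens a block and a marked letter joins the block to
its right. -/
theorem exists_blocksWord_eq {w : List (ℕ × Bool)} (hw : ValidWord w) :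
    ∃ π : List (Finset ℕ), (∀ B ∈ π, B.Nonempty) ∧ (∀ B, π.getLast? = some B → 0 ∉ B) ∧
      blocksWord π = w := by
  induction w with
  | nil => exact ⟨[], by simp, by simp, rfl⟩
  | cons y w ih =>
    obtain ⟨x, m⟩ := y
    obtain ⟨h1, h2, h3⟩ := linked_cons.1 hw
    obtain ⟨π, hπ, h0, rfl⟩ := ih h3
    cases m with
    | false =>
      refine ⟨{x} :: π, by simpa using hπ, ?_, by simp [blocksWord]⟩
      cases π with
      | nil => simpa [eq_comm] using (h2 rfl).1
      | cons C π => intro B hB; exact h0 B (by rwa [List.getLast?_cons_cons] at hB)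
    | true =>
      cases π with
      | nil => simpa using (h2 rfl).2
      | cons C π =>
        have hC := hπ C (by simp)
        have hx : ∀ b ∈ C, b < x := by
          intro b hb
          -- The word of `C` begins with its maximum, so comparing `x` with the next letter bounds
          -- all of `C`.
          have h4 := Finset.sort_insert (· ≥ ·) (s := C.erase (C.max' hC)) (a := C.max' hC)
            (fun b hb => C.le_max' b (Finset.mem_of_mem_erase hb)) (by simp)
          rw [Finset.insert_erase (C.max'_mem hC)] at h4
          have h5 := h1 (C.max' hC, decide (∃ y ∈ C, y < C.max' hC))
            (by simp [blocksWord, blockWord, h4]) rfl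
          exact (C.le_max' b hb).trans_lt h5
        refine ⟨insert x C :: π, ?_, ?_, ?_⟩
        · intro B hB
          rcases List.mem_cons.1 hB with rfl | hB
          · simp
          · exact hπ B (by simp [hB])
        · cases π with
          | nil =>
            have h5 := h0 C rfl
            obtain ⟨b, hb⟩ := hC
            have := hx b hb
            intro B hB
            obtain rfl : insert x C = B := by simpa using hB
            simp only [Finset.mem_insert, h5, or_false]
            omega
          | cons D π =>
            intro B hB
            exact h0 B (by rwa [List.getLast?_cons_cons] at hB ⊢)
        · simp [blocksWord, blockWord_insert hC hx]

theorem sigma_eq (π : List (Finset ℕ)) : (blocksWord π).map Prod.fst = sigma π := by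
  simp [blocksWord, blockWord, sigma, List.map_flatMap, Function.comp_def]

theorem coe_sigma (π : List (Finset ℕ)) : (sigma π : Multiset ℕ) = (π.map Finset.val).sum := by
  induction π with
  | nil => rfl
  | cons B π ih =>
    rw [List.map_cons, List.sum_cons, ← ih, sigma, List.flatMap_cons, ← Multiset.coe_add,
      Finset.sort_eq]
    rfl

theorem length_blocksWord {π : List (Finset ℕ)} (hπ : ∀ B ∈ π, B.Nonempty) :
    (blocksWord π).length = (blocksWord π).countP (fun x => x.2) + π.length := by
  have key : ∀ B : Finset ℕ, B.Nonempty →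
      (blockWord B).length = (blockWord B).countP (fun x => x.2) + 1 := by
    intro B hB
    induction B, hB using block_induction with
    | h1 x => simp
    | h2 x B hB hx ih => simp [blockWord_insert hB hx, ih]
  induction π with
  | nil => rfl
  | cons B π ih =>
    have h1 := ih fun C hC => hπ C (by simp [hC])
    have h2 := key B (hπ B (by simp))
    simp only [blocksWord, List.flatMap_cons, List.length_append, List.countP_append,
      List.length_cons] at *
    omega

/-! ### Parking functions whose areas are determined by their marked labels -/

/-- The label of a row, with its mark. -/
def Row.letter (x : Row) : ℕ × Bool := (x.label, x.mark)

/-- The list of rows with given marked labels: the first row has area `0`, and the area of the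
row with label `l` and mark `m` above `x` is `α l m x`. -/
def arrange (α : ℕ → Bool → Row → ℕ) : List (ℕ × Bool) → List Row
  | [] => []
  | (l, m) :: w =>
    match arrange α w with
    | [] => [⟨0, l, m⟩]
    | x :: V => ⟨α l m x, l, m⟩ :: x :: V

/-- The parking functions obtained by `arrange α` from valid words. -/
abbrev Arranged (α : ℕ → Bool → Row → ℕ) (V : List Row) : Prop :=
  Linked (fun y x => y.area = α y.label y.mark x ∧ (y.mark = true → x.label < y.label))
    Row.Bottom V

theorem arrange_cons_of_eq_cons {α : ℕ → Bool → Row → ℕ} {w : List (ℕ × Bool)} {x : Row}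
    {V : List Row} (h : arrange α w = x :: V) (l : ℕ) (m : Bool) :
    arrange α ((l, m) :: w) = ⟨α l m x, l, m⟩ :: x :: V := by
  rw [arrange, h]

theorem map_letter_arrange (α : ℕ → Bool → Row → ℕ) (w : List (ℕ × Bool)) :
    (arrange α w).map Row.letter = w := by
  induction w with
  | nil => rfl
  | cons y w ih =>
    obtain ⟨l, m⟩ := y
    cases h : arrange α w with
    | nil => rw [arrange, h]; rw [h] at ih; simp [← ih, Row.letter]
    | cons x V => rw [arrange_cons_of_eq_cons h, ← ih, h]; rfl

theorem arrange_map_letter {α : ℕ → Bool → Row → ℕ} {V : List Row} (hV : Arranged α V) :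
    arrange α (V.map Row.letter) = V := by
  induction V with
  | nil => rfl
  | cons y V ih =>
    have h := ih hV.tail
    cases V with
    | nil =>
      have h1 := (linked_singleton.1 hV).1
      simp [arrange, Row.letter, ← h1]
    | cons x V =>
      have h1 := (linked_cons_cons.1 hV).1.1
      rw [List.map_cons, Row.letter, arrange_cons_of_eq_cons h, ← h1]

theorem arranged_arrange {α : ℕ → Bool → Row → ℕ} {w : List (ℕ × Bool)} (hw : ValidWord w) :
    Arranged α (arrange α w) := by
  induction w with
  | nil => exact linked_nil
  | cons y w ih =>
    have h := ih hw.tail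
    have hm := map_letter_arrange α w
    obtain ⟨l, m⟩ := y
    cases h' : arrange α w with
    | nil =>
      rw [h', List.map_nil] at hm
      subst hm
      have := linked_singleton.1 hw
      simpa [arrange, Row.Bottom] using this
    | cons x V =>
      rw [h', List.map_cons] at hm
      subst hm
      rw [arrange_cons_of_eq_cons h']
      rw [h'] at h
      exact linked_cons_cons.2 ⟨⟨rfl, (linked_cons_cons.1 hw).1⟩, h⟩

theorem Arranged.validWord {α : ℕ → Bool → Row → ℕ} {V : List Row} (hV : Arranged α V) :
    ValidWord (V.map Row.letter) :=
  linked_map.2 (hV.imp (fun _ _ h => h.2) (fun _ h => h.2))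

theorem marks_eq_countP (V : List Row) : marks V = (V.map Row.letter).countP (fun x => x.2) := by
  rw [marks, List.countP_map]; rfl

theorem map_label_eq (V : List Row) : V.map Row.label = (V.map Row.letter).map Prod.fst := by
  rw [List.map_map]; rfl

/-- Once the areas are a function of the marked word, rows and words correspond, and valid words are
those of partitions. The condition on the bottom row (nonzero, unmarked) becomes the condition on
the last block. -/
theorem bijOn_arrange {M : Row → Row → Prop} {p : List Row → Prop} {α : ℕ → Bool → Row → ℕ}
    (h : ∀ V, Valid M V ∧ p V ↔ Arranged α V) (r : ℕ) {ℓ : ℕ} (β : Fin ℓ → ℕ) (m : ℤ) :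
    Set.BijOn (fun π => arrange α (blocksWord π)) (OP r β m)
      {V ∈ markedSet M r β m | p V} := by
  refine ⟨?_, ?_, ?_⟩
  · rintro π ⟨h1, h2, h3, h4⟩
    obtain ⟨h5, h6⟩ := (h _).2 (arranged_arrange (α := α) (validWord_blocksWord h1 h3))
    refine ⟨⟨h5, ?_, ?_⟩, h6⟩
    · rw [map_label_eq, map_letter_arrange, sigma_eq, coe_sigma, h2]
    · rw [marks_eq_countP, map_letter_arrange, ← List.length_map (f := Row.letter),
        map_letter_arrange, length_blocksWord h1]
      push_cast
      linarith
  · rintro π ⟨h1, -⟩ π' ⟨h1', -⟩ h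
    have h2 := congrArg (List.map Row.letter) h
    simp only [map_letter_arrange] at h2
    rw [← decodeWord_blocksWord h1, h2, decodeWord_blocksWord h1']
  · rintro V ⟨⟨h1, h2, h3⟩, h4⟩
    have h5 := (h V).1 ⟨h1, h4⟩
    obtain ⟨π, hπ, h0, hw⟩ := exists_blocksWord_eq h5.validWord
    refine ⟨π, ⟨hπ, ?_, h0, ?_⟩, ?_⟩
    · rw [← coe_sigma, ← sigma_eq, hw, ← map_label_eq, h2]
    · have h6 := length_blocksWord hπ
      rw [hw, ← marks_eq_countP, List.length_map] at h6
      rw [h6] at h3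
      push_cast at h3
      linarith
    · simp only [hw, arrange_map_letter h5]

/-! ### Parking functions with no area, and `inv` -/

theorem sum_map_sort (B : Finset ℕ) (s : ℕ → ℕ → Prop) [DecidableRel s] [Std.Total s]
    [IsTrans ℕ s] [Std.Antisymm s] (f : ℕ → ℕ) : ((B.sort s).map f).sum = ∑ x ∈ B, f x := by
  rw [← Multiset.sum_coe, ← Multiset.map_coe, Finset.sort_eq]
  rfl

/-- A row of area `0`. -/
def flatRow (x : ℕ × Bool) : Row := ⟨0, x.1, x.2⟩

theorem arrange_zero (w : List (ℕ × Bool)) : arrange (fun _ _ _ => 0) w = w.map flatRow := by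
  induction w with
  | nil => rfl
  | cons y w ih =>
    obtain ⟨l, m⟩ := y
    cases w with
    | nil => rfl
    | cons z w => rw [arrange_cons_of_eq_cons ih, List.map_cons, List.map_cons]; rfl

theorem arranged_cons_cons {α : ℕ → Bool → Row → ℕ} {y x : Row} {V : List Row} :
    Arranged α (y :: x :: V) ↔
      (y.area = α y.label y.mark x ∧ (y.mark = true → x.label < y.label)) ∧
        Arranged α (x :: V) := linked_cons_cons

/-- On a single diagonal, a contractible valley is a label larger than the one below it. -/
theorem valid_isVal_area_zero_iff (V : List Row) :
    Valid Row.IsVal V ∧ listArea V = 0 ↔ Arranged (fun _ _ _ => 0) V := by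
  induction V with
  | nil => simp
  | cons y V ih =>
    cases V with
    | nil => simp +contextual [Row.Bottom]
    | cons x V =>
      have hx : Arranged (fun _ _ _ => 0) (x :: V) → x.area = 0 := fun h => by
        have := (ih.2 h).2
        rw [listArea_cons] at this
        omega
      rw [Valid, linked_cons_cons, listArea_cons, arranged_cons_cons, ← ih]
      rw [← ih] at hx
      simp only [MarkedStep, Row.Step, Row.IsVal]
      constructor
      · rintro ⟨⟨⟨h1, h2⟩, h3⟩, h4⟩
        refine ⟨⟨by omega, fun h => ?_⟩, h3, by omega⟩
        have := h2 h
        have := listArea_cons x V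
        omega
      · rintro ⟨⟨h1, h2⟩, h3⟩
        have := hx h3
        exact ⟨⟨⟨⟨by omega, by omega⟩, fun h => Or.inr ⟨by omega, h2 h⟩⟩, h3.1⟩, by omega⟩

theorem attackers_flat_block {B : Finset ℕ} (hB : B.Nonempty) {x : ℕ} (hx : ∀ b ∈ B, b < x)
    (m : Bool) : attackers (flatRow (x, m)) ((blockWord B).map flatRow) = 1 := by
  induction B, hB using block_induction with
  | h1 y =>
    have := hx y (by simp)
    simp [attackers, flatRow, Row.Att, this]
  | h2 y B hB hy ih =>
    have := ih fun b hb => hx b (by simp [hb])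
    rw [blockWord_insert hB hy]
    simpa [attackers, flatRow] using this

theorem uDinv_flat_block {B : Finset ℕ} (hB : B.Nonempty) :
    uDinv ((blockWord B).map flatRow) = marks ((blockWord B).map flatRow) := by
  induction B, hB using block_induction with
  | h1 x => simp [attackers, flatRow]
  | h2 x B hB hx ih =>
    rw [blockWord_insert hB hx, List.map_cons, uDinv_cons, marks_cons, ih,
      attackers_flat_block hB hx, add_comm]
    simp [flatRow]

theorem marks_flatMap (f : Finset ℕ → List Row) (π : List (Finset ℕ)) :
    marks (π.flatMap f) = (π.map fun B => marks (f B)).sum := by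
  induction π with
  | nil => rfl
  | cons B π ih => simp [marks_append, ih]

/-- On one diagonal a pair is counted when its lower row is a block minimum and its upper label is
larger. Pairs between two blocks give `inv`; inside a block each marked letter is paired with the
minimum, which gives the marks. -/
theorem uDinv_flat_eq {π : List (Finset ℕ)} (hπ : ∀ B ∈ π, B.Nonempty) :
    uDinv ((blocksWord π).map flatRow) = inv π + marks ((blocksWord π).map flatRow) := by
  rw [blocksWord, List.map_flatMap, uDinv, pairSum_flatMap, marks_flatMap, inv]
  congr 1
  · rw [← pairSum_eq_sum_get (fun B C => #{p ∈ B ×ˢ C | p.2 < p.1 ∧ ∀ c ∈ C, p.2 ≤ c})]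
    congr 1
    funext B C
    simp only [crossSum, blockWord, List.map_map, Function.comp_def]
    rw [sum_map_sort, Finset.card_filter, Finset.sum_product]
    refine Finset.sum_congr rfl fun y _ => ?_
    rw [sum_map_sort]
    refine Finset.sum_congr rfl fun x _ => ?_
    refine if_congr ?_ rfl rfl
    simp only [flatRow, Row.Att, decide_eq_false_iff_not, not_exists, not_and, not_lt, true_and]
    rw [and_comm]
    exact and_congr_left fun _ => by simp
  · congr 1
    exact List.map_congr_left fun B hB => uDinv_flat_block (hπ B hB)

theorem exists_bijOn_inv (r : ℕ) {ℓ : ℕ} (β : Fin ℓ → ℕ) (m : ℤ) :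
    ∃ Φ : List (Finset ℕ) → List Row,
      Set.BijOn Φ (OP r β m) {V ∈ markedSet Row.IsVal r β m | listArea V = 0} ∧
        ∀ π ∈ OP r β m, uDinv (Φ π) - marks (Φ π) = inv π := by
  refine ⟨_, bijOn_arrange valid_isVal_area_zero_iff r β m, fun π hπ => ?_⟩
  simp only [arrange_zero]
  rw [uDinv_flat_eq hπ.1, Nat.add_sub_cancel]

/-! ### Parking functions without dinv, and `maj` -/

/-- The area of a row with label `l` above `x`, when there is no valley. -/
def ascArea (l : ℕ) (_ : Bool) (x : Row) : ℕ := if x.label < l then x.area + 1 else x.area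

/-- The number of descents of a word. -/
def desc : List ℕ → ℕ
  | [] => 0
  | [_] => 0
  | x :: y :: l => (if y < x then 1 else 0) + desc (y :: l)

@[simp] theorem desc_cons_cons (x y : ℕ) (l : List ℕ) :
    desc (x :: y :: l) = (if y < x then 1 else 0) + desc (y :: l) := rfl

theorem listDinv_cons (y : Row) (V : List Row) :
    listDinv (y :: V) = (V.map fun x => if x.Att y then 1 else 0).sum + listDinv V := rfl

theorem Arranged.not_isVal {V : List Row} {y : Row} (h : Arranged ascArea (y :: V)) :
    ∀ x ∈ V, ¬ y.IsVal x := by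
  induction V generalizing y with
  | nil => simp
  | cons z V ih =>
    have h1 := (linked_cons_cons.1 h).1.1
    have h2 := ih h.tail
    have h3 : ¬ y.IsVal z := by
      simp only [ascArea] at h1
      simp only [Row.IsVal]
      split_ifs at h1 <;> omega
    intro x hx
    rcases List.mem_cons.1 hx with rfl | hx
    · exact h3
    · have := h2 x hx
      simp only [Row.IsVal] at *
      omega

/-- A contractible valley would be attacked (`exists_att`), so dinv 0 excludes valleys. A step that
is not a valley raises the area by one if the label increases and preserves it otherwise.
Conversely, without valleys no row precedes a lower one, and an attacked row precedes its attacker.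
-/
theorem valid_isRise_dinv_zero_iff (V : List Row) :
    Valid Row.IsRise V ∧ listDinv V = 0 ↔ Arranged ascArea V := by
  induction V with
  | nil => simp [listDinv]
  | cons y V ih =>
    cases V with
    | nil => simp [listDinv]
    | cons x V =>
      constructor
      · rintro ⟨h1, h2⟩
        rw [listDinv_cons, Nat.add_eq_zero_iff] at h2
        refine linked_cons_cons.2 ⟨?_, ih.1 ⟨h1.tail, h2.2⟩⟩
        have h3 := (linked_cons_cons.1 h1).1
        have h4 : ¬ y.IsVal x := by
          intro h
          obtain ⟨A, z, D, h5, h6, -⟩ := exists_att (Valid.step h1.tail) ⟨x, by simp, h⟩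
          have h7 := h2.1
          rw [h5] at h7
          simp [h6] at h7
        simp only [MarkedStep, Row.Step, Row.IsRise, Row.IsVal] at h3 h4
        refine ⟨?_, fun h => h3.1.2 (h3.2 h)⟩
        rw [ascArea]
        split_ifs <;> omega
      · intro h
        obtain ⟨h1, h2⟩ := ih.2 h.tail
        refine ⟨linked_cons_cons.2 ⟨?_, h1⟩, ?_⟩
        · have h3 := (linked_cons_cons.1 h).1
          simp only [MarkedStep, Row.Step, Row.IsRise, ascArea] at h3 ⊢
          split_ifs at h3 with h4
          · exact ⟨⟨by omega, fun _ => h4⟩, fun _ => h3.1⟩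
          · exact ⟨⟨by omega, by omega⟩, fun h => absurd (h3.2 h) h4⟩
        · rw [listDinv_cons, h2, add_zero, List.sum_eq_zero_iff]
          simp only [List.mem_map]
          rintro _ ⟨z, hz, rfl⟩
          have h3 := Arranged.not_isVal h z hz
          rw [if_neg]
          simp only [Row.IsVal, Row.Att] at *
          omega

theorem arrange_ascArea (l : ℕ) (m : Bool) (w : List (ℕ × Bool)) :
    arrange ascArea ((l, m) :: w) =
      ⟨desc (l :: w.map Prod.fst), l, m⟩ :: arrange ascArea w := by
  induction w generalizing l m with
  | nil => rfl
  | cons y w ih =>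
    obtain ⟨l', m'⟩ := y
    rw [arrange_cons_of_eq_cons (ih l' m'), ih]
    simp only [ascArea, List.map_cons, desc_cons_cons]
    split_ifs <;> simp [add_comm]

/-- Only the minimum of the block is unmarked, and its area counts the descents from its letter on.
-/
theorem uArea_arrange_block {B : Finset ℕ} (hB : B.Nonempty) (w : List (ℕ × Bool)) :
    uArea (arrange ascArea (blockWord B ++ w)) =
      desc (B.min' hB :: w.map Prod.fst) + uArea (arrange ascArea w) := by
  induction B, hB using block_induction with
  | h1 x => simp [arrange_ascArea]
  | h2 x B hB hx ih =>
    rw [blockWord_insert hB hx, List.cons_append, arrange_ascArea, uArea_cons, if_pos rfl, ih,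
      Finset.min'_insert x B hB, min_eq_right (hx _ (B.min'_mem hB)).le, zero_add]

/-! ### The major index, block by block -/

/-- The sum of the second components of the letters of a word following a descent. -/
def pairMaj : List (ℕ × ℕ) → ℕ
  | [] => 0
  | [_] => 0
  | x :: y :: l => (if y.1 < x.1 then y.2 else 0) + pairMaj (y :: l)

@[simp] theorem pairMaj_cons_cons (x y : ℕ × ℕ) (l : List (ℕ × ℕ)) :
    pairMaj (x :: y :: l) = (if y.1 < x.1 then y.2 else 0) + pairMaj (y :: l) := rfl

theorem pairMaj_zip {s d : List ℕ} (h : s.length = d.length) :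
    pairMaj (s.zip d) =
      ∑ i ∈ range (s.length - 1), if s.getD (i + 1) 0 < s.getD i 0 then d.getD (i + 1) 0 else 0 := by
  induction s generalizing d with
  | nil => rfl
  | cons x s ih =>
    cases d with
    | nil => simp at h
    | cons e d =>
      cases s with
      | nil => simp at h; subst h; rfl
      | cons y s =>
        cases d with
        | nil => simp at h
        | cons f d =>
          have := ih (d := f :: d) (by simpa using h)
          simp only [List.zip_cons_cons] at this
          simp only [List.zip_cons_cons, pairMaj_cons_cons, this, List.length_cons,
            Nat.add_sub_cancel]
          rw [Finset.sum_range_succ', add_comm]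
          simp

/-- Descents inside the block end at letters of index 0; only the minimum is compared with a letter
of `L`. -/
theorem pairMaj_block {B : Finset ℕ} (hB : B.Nonempty) (L : List (ℕ × ℕ)) :
    pairMaj ((B.sort (· ≥ ·)).map (fun x => (x, 0)) ++ L) = pairMaj ((B.min' hB, 0) :: L) := by
  induction B, hB using block_induction with
  | h1 x => simp
  | h2 x B hB hx ih =>
    rw [Finset.sort_insert _ (fun b hb => (hx b hb).le) (fun h => (hx x h).false)]
    rw [Finset.min'_insert x B hB, min_eq_right (hx _ (B.min'_mem hB)).le, ← ih]
    cases h : B.sort (· ≥ ·) with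
    | nil =>
      have := congrArg List.length h
      simp [hB.ne_empty] at this
    | cons y l => simp

theorem pairMaj_map_succ (L : List (ℕ × ℕ)) :
    pairMaj (L.map fun x => (x.1, x.2 + 1)) = pairMaj L + desc (L.map Prod.fst) := by
  induction L with
  | nil => rfl
  | cons x L ih =>
    cases L with
    | nil => rfl
    | cons y L =>
      simp only [List.map_cons, pairMaj_cons_cons, desc_cons_cons] at *
      rw [ih]
      split_ifs <;> omega

/-- Raising all indices by one counts every descent once more. The descent from `x` to the head
counts 1 because the head has index 0 before the shift. -/
theorem pairMaj_cons_map_succ {L : List (ℕ × ℕ)} (hL : ∀ y ∈ L.head?, y.2 = 0) (x : ℕ) :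
    pairMaj ((x, 0) :: L.map fun x => (x.1, x.2 + 1)) =
      desc (x :: L.map Prod.fst) + pairMaj L := by
  cases L with
  | nil => rfl
  | cons y L =>
    have h1 := pairMaj_map_succ (y :: L)
    have h2 : y.2 = 0 := hL y rfl
    simp only [List.map_cons, pairMaj_cons_cons, desc_cons_cons] at *
    rw [h1]
    split_ifs <;> omega

theorem ind_cons (B : Finset ℕ) (π : List (Finset ℕ)) :
    ind (B :: π) = List.replicate #B 0 ++ (ind π).map (· + 1) := by
  rw [ind, List.mapIdx_cons, List.flatten_cons, ind, List.map_flatten]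
  congr 2
  exact List.ext_getElem (by simp) (by simp)

theorem length_sigma (π : List (Finset ℕ)) : (sigma π).length = (ind π).length := by
  induction π with
  | nil => rfl
  | cons B π ih =>
    rw [ind_cons, List.length_append, List.length_map, ← ih]
    simp [sigma]

theorem zip_sigma_ind_cons (B : Finset ℕ) (π : List (Finset ℕ)) :
    (sigma (B :: π)).zip (ind (B :: π)) = (B.sort (· ≥ ·)).map (fun x => (x, 0)) ++
      ((sigma π).zip (ind π)).map fun x => (x.1, x.2 + 1) := by
  rw [ind_cons, sigma, List.flatMap_cons, ← sigma, List.zip_append (by simp), List.zip_map_right]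
  congr 1
  have : ∀ l : List ℕ, l.zip (List.replicate l.length 0) = l.map fun x => (x, 0) := by
    intro l
    induction l with
    | nil => rfl
    | cons x l ih => simp [List.replicate_succ, ih]
  rw [← this, Finset.length_sort]

/-- The descent between positions `i` and `i + 1` is counted once by the minimum of each block
ending at or before `i`, and there are `ind_{i+1}` such blocks. -/
theorem opMaj_eq {π : List (Finset ℕ)} (hπ : ∀ B ∈ π, B.Nonempty) :
    uArea (arrange ascArea (blocksWord π)) = opMaj π := by
  have h1 : ∀ π : List (Finset ℕ), opMaj π = pairMaj ((sigma π).zip (ind π)) := fun π => by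
    rw [pairMaj_zip (length_sigma π), opMaj]
  rw [h1]
  induction π with
  | nil => rfl
  | cons B π ih =>
    have hB := hπ B (by simp)
    have h2 := ih fun C hC => hπ C (by simp [hC])
    rw [blocksWord, List.flatMap_cons, ← blocksWord, uArea_arrange_block hB, h2,
      zip_sigma_ind_cons, pairMaj_block hB, pairMaj_cons_map_succ, sigma_eq,
      List.map_fst_zip (length_sigma π).le]
    intro y hy
    cases π with
    | nil => simp [sigma] at hy
    | cons C π =>
      have hC : (C.sort (· ≥ ·)).map (fun x => (x, 0)) ≠ [] := by
        intro h
        have := congrArg List.length h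
        simp [(hπ C (by simp)).ne_empty] at this
      rw [zip_sigma_ind_cons, List.head?_append_of_ne_nil _ hC] at hy
      have := List.mem_of_mem_head? hy
      simp only [List.mem_map] at this
      obtain ⟨_, -, rfl⟩ := this
      rfl

theorem exists_bijOn_opMaj (r : ℕ) {ℓ : ℕ} (β : Fin ℓ → ℕ) (m : ℤ) :
    ∃ Φ : List (Finset ℕ) → List Row,
      Set.BijOn Φ (OP r β m) {V ∈ markedSet Row.IsRise r β m | listDinv V = 0} ∧
        ∀ π ∈ OP r β m, uArea (Φ π) = opMaj π :=
  ⟨_, bijOn_arrange valid_isRise_dinv_zero_iff r β m, fun _ hπ => opMaj_eq hπ.1⟩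

/-! ### Parking functions without unmarked area, and `dinv` -/

/-- The area of a row with mark `m` above `x`, when all unmarked rows have area `0`. -/
def runArea (_ : ℕ) (m : Bool) (x : Row) : ℕ := if m then x.area + 1 else 0

/-- An unmarked row lies on the diagonal and a marked one is a double rise, so its label exceeds the
one below. -/
theorem valid_isRise_uArea_zero_iff (V : List Row) :
    Valid Row.IsRise V ∧ uArea V = 0 ↔ Arranged runArea V := by
  induction V with
  | nil => simp
  | cons y V ih =>
    cases V with
    | nil => simp +contextual [Row.Bottom]
    | cons x V =>
      rw [Valid, linked_cons_cons, uArea_cons, arranged_cons_cons, ← ih]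
      simp only [MarkedStep, Row.Step, Row.IsRise, runArea]
      cases y.mark
      · simp only [Bool.false_eq_true, if_false, false_imp_iff, and_true]
        constructor
        · rintro ⟨⟨h1, h2⟩, h3⟩
          exact ⟨by omega, h2, by omega⟩
        · rintro ⟨h1, h2, h3⟩
          exact ⟨⟨⟨by omega, by omega⟩, h2⟩, by omega⟩
      · simp only [if_true, true_imp_iff]
        constructor
        · rintro ⟨⟨⟨h1, h1'⟩, h2⟩, h3⟩
          exact ⟨⟨h1', h1.2 h1'⟩, h2, by omega⟩
        · rintro ⟨⟨h1, h1'⟩, h2, h3⟩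
          exact ⟨⟨⟨⟨by omega, fun _ => h1'⟩, h1⟩, h2⟩, by omega⟩

/-- The rows of a column with label set `B`, all but the lowest one being marked. -/
def columnRows (B : Finset ℕ) : List Row :=
  ((List.range #B).map fun h => (⟨h, nthSmallest B h, decide (h ≠ 0)⟩ : Row)).reverse

theorem sort_le_insert {B : Finset ℕ} {x : ℕ} (hx : ∀ b ∈ B, b < x) :
    (insert x B).sort (· ≤ ·) = B.sort (· ≤ ·) ++ [x] := by
  refine List.Perm.eq_of_sortedLE (Finset.sortedLT_sort _).sortedLE ?_ ?_
  · refine List.Pairwise.sortedLE ?_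
    rw [List.pairwise_append]
    refine ⟨(Finset.sortedLT_sort B).sortedLE.pairwise, by simp, ?_⟩
    intro a ha b hb
    obtain rfl : b = x := by simpa using hb
    exact (hx a (by simpa using ha)).le
  · rw [← Multiset.coe_eq_coe, ← Multiset.coe_add, Finset.sort_eq, Finset.sort_eq,
      Finset.insert_val_of_notMem fun h => (hx x h).false, add_comm]
    rfl

theorem columnRows_insert {B : Finset ℕ} (hB : B.Nonempty) {x : ℕ} (hx : ∀ b ∈ B, b < x) :
    columnRows (insert x B) = ⟨#B, x, true⟩ :: columnRows B := by
  rw [columnRows, Finset.card_insert_of_notMem fun h => (hx x h).false, List.range_succ,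
    List.map_append, List.reverse_append, columnRows]
  simp only [List.map_cons, List.map_nil, List.reverse_cons, List.reverse_nil, List.nil_append,
    List.singleton_append, List.cons.injEq, Row.mk.injEq, true_and]
  refine ⟨⟨?_, by simpa using hB.ne_empty⟩, ?_⟩
  · rw [nthSmallest, sort_le_insert hx, List.getD_append_right _ _ _ _ (by simp)]
    simp
  · congr 1
    refine List.map_congr_left fun h hh => ?_
    rw [nthSmallest, sort_le_insert hx, List.getD_append _ _ _ _ (by simpa using hh), nthSmallest]

theorem columnRows_eq_cons {B : Finset ℕ} (hB : B.Nonempty) :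
    ∃ x V, columnRows B = x :: V ∧ x.area + 1 = #B := by
  induction B, hB using block_induction with
  | h1 x => exact ⟨_, _, rfl, rfl⟩
  | h2 x B hB hx ih =>
    rw [columnRows_insert hB hx, Finset.card_insert_of_notMem fun h => (hx x h).false]
    exact ⟨_, _, rfl, rfl⟩

theorem arrange_runArea_block {B : Finset ℕ} (hB : B.Nonempty) (w : List (ℕ × Bool)) :
    arrange runArea (blockWord B ++ w) = columnRows B ++ arrange runArea w := by
  induction B, hB using block_induction with
  | h1 x =>
    have h2 : columnRows {x} = [⟨0, x, false⟩] := by simp [columnRows, nthSmallest]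
    rw [h2, blockWord_singleton, List.singleton_append]
    cases h : arrange runArea w with
    | nil => rw [arrange, h]; rfl
    | cons y V => rw [arrange_cons_of_eq_cons h]; rfl
  | h2 x B hB hx ih =>
    obtain ⟨y, V, h1, h2⟩ := columnRows_eq_cons hB
    rw [h1] at ih
    rw [blockWord_insert hB hx, List.cons_append, arrange_cons_of_eq_cons ih,
      columnRows_insert hB hx, h1, ← h2]
    rfl

theorem arrange_runArea_blocksWord {π : List (Finset ℕ)} (hπ : ∀ B ∈ π, B.Nonempty) :
    arrange runArea (blocksWord π) = π.flatMap columnRows := by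
  induction π with
  | nil => rfl
  | cons B π ih =>
    rw [blocksWord, List.flatMap_cons, List.flatMap_cons, arrange_runArea_block (hπ B (by simp)),
      ← blocksWord, ih fun C hC => hπ C (by simp [hC])]

theorem sum_map_columnRows (B : Finset ℕ) (f : Row → ℕ) :
    ((columnRows B).map f).sum =
      ∑ h ∈ range #B, f ⟨h, nthSmallest B h, decide (h ≠ 0)⟩ := by
  rw [columnRows, List.map_reverse, List.sum_reverse, List.map_map]
  generalize #B = N
  induction N with
  | zero => rfl
  | succ N ih =>
    rw [List.range_succ, List.map_append, List.sum_append, Finset.sum_range_succ, ih]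
    simp

/-- Areas strictly increase upwards in a column, whereas the lower row of a dinv pair has at least
the area of the upper one. -/
theorem listDinv_columnRows (B : Finset ℕ) : listDinv (columnRows B) = 0 := by
  rw [listDinv, columnRows, pairSum_reverse, pairSum_map]
  have : ∀ N : ℕ, (List.range N).Pairwise (· < ·) := fun N => List.pairwise_lt_range
  have h2 : ∀ l : List ℕ, l.Pairwise (· < ·) → ∀ g : ℕ → ℕ → ℕ, (∀ i j, i < j → g i j = 0) →
      pairSum g l = 0 := by
    intro l hl g hg
    induction hl with
    | nil => rfl
    | cons h1 _ ih =>
      rw [pairSum_cons, ih, add_zero, List.sum_eq_zero_iff]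
      simp only [List.mem_map]
      rintro _ ⟨j, hj, rfl⟩
      exact hg _ _ (h1 j hj)
  refine h2 _ (this _) _ fun i j hij => ?_
  rw [if_neg]
  simp only [Row.Att]
  omega

/-- In two columns the row of area `h` has the label of rank `h`, so pairs on equal areas are the
primary dinvs and pairs one diagonal apart are the secondary ones. -/
theorem listDinv_flatMap_columnRows (π : List (Finset ℕ)) :
    listDinv (π.flatMap columnRows) = opDinv π := by
  rw [listDinv, pairSum_flatMap]
  rw [show (π.map fun B => pairSum (fun y x => if x.Att y then 1 else 0) (columnRows B)) =
    π.map fun _ => 0 from List.map_congr_left fun B _ => listDinv_columnRows B]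
  rw [opDinv, ← pairSum_eq_sum_get (fun B C =>
    (#{h ∈ range #B | h < #C ∧ nthSmallest C h < nthSmallest B h} +
      #{h ∈ range #B | h + 1 < #C ∧ nthSmallest B h < nthSmallest C (h + 1)}))]
  simp only [List.map_const', List.sum_replicate, smul_zero, add_zero]
  congr 1
  funext B C
  rw [crossSum, sum_map_columnRows, Finset.card_filter, Finset.card_filter,
    ← Finset.sum_add_distrib]
  refine Finset.sum_congr rfl fun h _ => ?_
  rw [sum_map_columnRows]
  -- Only rows of area `h` and `h + 1` in the lower column can attack a row of area `h` in the upper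
  -- one.
  have : ∀ i, (if Row.Att ⟨i, nthSmallest C i, decide (i ≠ 0)⟩
      ⟨h, nthSmallest B h, decide (h ≠ 0)⟩ then 1 else 0) =
      (if i = h then (if nthSmallest C h < nthSmallest B h then 1 else 0) else 0) +
      (if i = h + 1 then (if nthSmallest B h < nthSmallest C (h + 1) then 1 else 0) else 0) := by
    intro i
    rcases eq_or_ne i h with rfl | h1
    · simp [Row.Att]
    · rcases eq_or_ne i (h + 1) with rfl | h2
      · simp [Row.Att]
      · simp [Row.Att, h1, h2]
  simp only [this, Finset.sum_add_distrib, Finset.sum_ite_eq', Finset.mem_range, ite_and]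

theorem exists_bijOn_opDinv (r : ℕ) {ℓ : ℕ} (β : Fin ℓ → ℕ) (m : ℤ) :
    ∃ Φ : List (Finset ℕ) → List Row,
      Set.BijOn Φ (OP r β m) {V ∈ markedSet Row.IsRise r β m | uArea V = 0} ∧
        ∀ π ∈ OP r β m, listDinv (Φ π) = opDinv π := by
  refine ⟨_, bijOn_arrange valid_isRise_uArea_zero_iff r β m, fun π hπ => ?_⟩
  simp only [arrange_runArea_blocksWord hπ.1, listDinv_flatMap_columnRows]

/-! ### Blocks of the word of `minimaj` -/

theorem Row.IsVal.trans {x y z : Row} (h : x.IsVal y) (h' : y.IsVal z) : x.IsVal z := by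
  simp only [Row.IsVal] at *
  omega

instance : IsTrans Row Row.IsVal := ⟨fun _ _ _ => Row.IsVal.trans⟩

theorem Row.IsVal.step {x y : Row} (h : x.IsVal y) : x.Step y := by
  simp only [Row.IsVal, Row.Step] at *
  omega

/-- The area and the label of a row. -/
def Row.pos (x : Row) : ℕ × ℕ := (x.area, x.label)

/-- The order of `Row.IsVal` on areas and labels. -/
def PosLt (p p' : ℕ × ℕ) : Prop := p.1 < p'.1 ∨ (p.1 = p'.1 ∧ p'.2 < p.2)

/-- The areas and labels of the rows of a block written to the left of a letter `l` whose row has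
area `a`. -/
def blockPos (a l : ℕ) (B : Finset ℕ) : List (ℕ × ℕ) :=
  (({x ∈ B | x ≤ l} : Finset ℕ).sort (· ≥ ·)).map (fun x => (a, x)) ++
    (({x ∈ B | l < x} : Finset ℕ).sort (· ≥ ·)).map (fun x => (a + 1, x))

/-- `p` is one of the positions which may occur in `blockPos a l`. -/
def Window (a l : ℕ) (p : ℕ × ℕ) : Prop := (p.1 = a ∧ p.2 ≤ l) ∨ (p.1 = a + 1 ∧ l < p.2)

theorem mem_blockPos {a l : ℕ} {B : Finset ℕ} {p : ℕ × ℕ} :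
    p ∈ blockPos a l B ↔ p.2 ∈ B ∧ Window a l p := by
  obtain ⟨p1, p2⟩ := p
  simp only [blockPos, List.mem_append, List.mem_map, Finset.mem_sort, Finset.mem_filter,
    Prod.mk.injEq, Window]
  constructor
  · rintro (⟨x, ⟨h1, h2⟩, rfl, rfl⟩ | ⟨x, ⟨h1, h2⟩, rfl, rfl⟩)
    · exact ⟨h1, Or.inl ⟨rfl, h2⟩⟩
    · exact ⟨h1, Or.inr ⟨rfl, h2⟩⟩
  · rintro ⟨h1, ⟨rfl, h2⟩ | ⟨rfl, h2⟩⟩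
    · exact Or.inl ⟨p2, ⟨h1, h2⟩, rfl, rfl⟩
    · exact Or.inr ⟨p2, ⟨h1, h2⟩, rfl, rfl⟩

theorem pairwise_blockPos (a l : ℕ) (B : Finset ℕ) : (blockPos a l B).Pairwise PosLt := by
  rw [blockPos, List.pairwise_append, List.pairwise_map, List.pairwise_map]
  refine ⟨(Finset.sortedGT_sort _).pairwise.imp fun h => Or.inr ⟨rfl, h⟩,
    (Finset.sortedGT_sort _).pairwise.imp fun h => Or.inr ⟨rfl, h⟩, ?_⟩
  simp only [List.mem_map]
  rintro _ ⟨x, -, rfl⟩ _ ⟨y, -, rfl⟩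
  exact Or.inl (Nat.lt_succ_self a)

theorem coe_map_snd_blockPos (a l : ℕ) (B : Finset ℕ) :
    ((blockPos a l B).map Prod.snd : Multiset ℕ) = B.val := by
  rw [blockPos, List.map_append, List.map_map, List.map_map, ← Multiset.coe_add]
  simp only [Function.comp_def, List.map_id', Finset.sort_eq]
  rw [Finset.filter_val, Finset.filter_val]
  conv_rhs => rw [← Multiset.filter_add_not (fun x => x ≤ l) B.val]
  simp only [not_le]

theorem reverse_sort_ge (B : Finset ℕ) : (B.sort (· ≥ ·)).reverse = B.sort (· ≤ ·) := by
  refine List.Perm.eq_of_sortedLE ?_ (Finset.sortedLT_sort _).sortedLE ?_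
  · exact (List.pairwise_reverse.2 ((Finset.sortedGT_sort B).sortedGE.pairwise)).sortedLE
  · rw [← Multiset.coe_eq_coe, Multiset.coe_reverse, Finset.sort_eq, Finset.sort_eq]

theorem reverse_map_snd_blockPos (a l : ℕ) (B : Finset ℕ) :
    ((blockPos a l B).map Prod.snd).reverse =
      ({x ∈ B | l < x} : Finset ℕ).sort (· ≤ ·) ++ ({x ∈ B | x ≤ l} : Finset ℕ).sort (· ≤ ·) := by
  rw [blockPos, List.map_append, List.map_map, List.map_map, List.reverse_append]
  simp only [Function.comp_def, List.map_id', reverse_sort_ge]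

theorem PosLt.irrefl (p : ℕ × ℕ) : ¬ PosLt p p := by simp [PosLt]

/-- A window has exactly one position for each label, and a list sorted by a strict order is
determined by its members. -/
theorem eq_blockPos {a l : ℕ} {Q : List (ℕ × ℕ)} (hQ : Q.Pairwise PosLt)
    (h : ∀ p ∈ Q, Window a l p) : Q = blockPos a l (Q.map Prod.snd).toFinset := by
  have nodup : ∀ {Q : List (ℕ × ℕ)}, Q.Pairwise PosLt → Q.Nodup := by
    intro Q h
    refine List.Pairwise.imp ?_ h
    rintro p _ h rfl
    exact PosLt.irrefl p h
  refine List.Perm.eq_of_pairwise (le := PosLt) ?_ hQ (pairwise_blockPos _ _ _) ?_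
  · intro p p' _ _ h1 h2
    simp only [PosLt] at h1 h2
    omega
  · rw [List.perm_ext_iff_of_nodup (nodup hQ) (nodup (pairwise_blockPos _ _ _))]
    intro p
    rw [mem_blockPos]
    simp only [List.mem_toFinset, List.mem_map]
    refine ⟨fun hp => ⟨⟨p, hp, rfl⟩, h p hp⟩, ?_⟩
    rintro ⟨⟨p', hp', h1⟩, h2⟩
    have h3 := h p' hp'
    have : p' = p := by
      refine Prod.ext ?_ h1
      simp only [Window] at h2 h3
      omega
    exact this ▸ hp'

/-- `N` followed by `v` are the rows of a block written to the left of a letter `l` whose row has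
area `a`; the last one is unmarked. -/
structure IsBlock (a l : ℕ) (B : Finset ℕ) (N : List Row) (v : Row) : Prop where
  map_pos : (N ++ [v]).map Row.pos = blockPos a l B
  mark : ∀ x ∈ N, x.mark = true
  last : v.mark = false

namespace IsBlock

variable {a l : ℕ} {B : Finset ℕ} {N : List Row} {v : Row}

theorem pairwise (h : IsBlock a l B N v) : (N ++ [v]).Pairwise Row.IsVal := by
  have := pairwise_blockPos a l B
  rw [← h.map_pos, List.pairwise_map] at this
  exact this

theorem window (h : IsBlock a l B N v) {x : Row} (hx : x ∈ N ++ [v]) : Window a l x.pos := by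
  have := List.mem_map_of_mem (f := Row.pos) hx
  rw [h.map_pos, mem_blockPos] at this
  exact this.2

theorem map_label (h : IsBlock a l B N v) :
    (N ++ [v]).map Row.label = (blockPos a l B).map Prod.snd := by
  rw [← h.map_pos, List.map_map]
  rfl

theorem coe_labels (h : IsBlock a l B N v) :
    ((N ++ [v]).map Row.label : Multiset ℕ) = B.val := by
  rw [h.map_label, coe_map_snd_blockPos]

theorem unique (h : IsBlock a l B N v) {N' : List Row} {v' : Row} (h' : IsBlock a l B N' v') :
    N = N' ∧ v = v' := by
  have h1 := h.map_pos.trans h'.map_pos.symm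
  rw [List.map_append, List.map_append] at h1
  obtain ⟨h2, h3⟩ := List.append_inj' h1 rfl
  have key : ∀ x y : Row, x.pos = y.pos → x.mark = y.mark → x = y := by
    intro x y h1 h2
    simp only [Row.pos, Prod.mk.injEq] at h1
    exact Row.ext h1.1 h1.2 h2
  constructor
  · have hlen : N.length = N'.length := by simpa using congrArg List.length h2
    refine List.ext_getElem hlen fun i hi hi' => key _ _ ?_ ?_
    · have := List.getElem_of_eq h2 (i := i) (by simpa using hi)
      simpa using this
    · rw [h.mark _ (List.getElem_mem hi), h'.mark _ (List.getElem_mem hi')]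
  · refine key _ _ (by simpa using h3) (by rw [h.last, h'.last])

theorem eq_of_rows (h : IsBlock a l B N v) {B' : Finset ℕ} (h' : IsBlock a l B' N v) : B = B' :=
  Finset.val_injective (h.coe_labels.symm.trans h'.coe_labels)

theorem val_last (h : IsBlock a l B N v) {x : Row} (hx : x ∈ N) : x.IsVal v :=
  (List.pairwise_append.1 h.pairwise).2.2 x hx v (by simp)

end IsBlock

theorem exists_isBlock (a l : ℕ) {B : Finset ℕ} (hB : B.Nonempty) :
    ∃ N v, IsBlock a l B N v := by
  rcases List.eq_nil_or_concat (blockPos a l B) with h | ⟨L, p, h⟩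
  · have := coe_map_snd_blockPos a l B
    rw [h] at this
    exact absurd (Finset.val_eq_zero.1 this.symm) hB.ne_empty
  · refine ⟨L.map fun p => ⟨p.1, p.2, true⟩, ⟨p.1, p.2, false⟩, ?_, ?_, rfl⟩
    · rw [h]
      simp [Row.pos, Function.comp_def]
    · simp only [List.mem_map]
      rintro _ ⟨_, -, rfl⟩
      rfl

theorem isBlock_of_pairwise {a l : ℕ} {N : List Row} {v : Row}
    (h : (N ++ [v]).Pairwise Row.IsVal) (hw : ∀ x ∈ N ++ [v], Window a l x.pos)
    (hN : ∀ x ∈ N, x.mark = true) (hv : v.mark = false) :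
    IsBlock a l ((N ++ [v]).map Row.label).toFinset N v := by
  refine ⟨?_, hN, hv⟩
  have := eq_blockPos (a := a) (l := l) (Q := (N ++ [v]).map Row.pos)
    (List.pairwise_map.2 h) (by
      simp only [List.mem_map]
      rintro _ ⟨x, hx, rfl⟩
      exact hw x hx)
  rwa [List.map_map] at this

/-! ### The construction of parking functions for `minimaj` -/

/-- The parking function of an ordered multiset partition, built from the right: the rows of a new
block are inserted in such a way that the rows of the previous ones that are not at distance less
than one diagonal from its unmarked row `v` stay above it. -/
inductive Build : List (Finset ℕ) → List Row → Prop
  | nil : Build [] []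
  -- With the maximum of `B` as reference label no label exceeds it, so the whole block has area 0.
  | base {B : Finset ℕ} {N : List Row} {v : Row} (h0 : 0 ∉ B)
      (hb : IsBlock 0 (B.sup id) B N v) : Build [B] (N ++ [v])
  | step {π : List (Finset ℕ)} {B : Finset ℕ} {T T' N R : List Row} {u v : Row}
      (h : Build π (T ++ (T' ++ u :: R))) (hT : ∀ x ∈ T, x.mark = true)
      (hT' : ∀ x ∈ T', x.mark = true) (hu : u.mark = false)
      (hb : IsBlock u.area u.label B N v) (hTv : ∀ x ∈ T, ¬ v.Step x)
      (hTv' : ∀ x ∈ T', v.Step x) : Build (B :: π) (T ++ (N ++ v :: (T' ++ u :: R)))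

theorem append_cons_inj {α : Type*} {p : α → Prop} {A A' D D' : List α} {x x' : α}
    (hA : ∀ y ∈ A, p y) (hA' : ∀ y ∈ A', p y) (hx : ¬ p x) (hx' : ¬ p x')
    (h : A ++ x :: D = A' ++ x' :: D') : A = A' ∧ x = x' ∧ D = D' := by
  induction A generalizing A' with
  | nil =>
    cases A' with
    | nil => simpa using h
    | cons y A' =>
      simp only [List.nil_append, List.cons_append, List.cons.injEq] at h
      exact absurd (hA' y (by simp)) (h.1 ▸ hx)
  | cons y A ih =>
    cases A' with
    | nil =>
      simp only [List.nil_append, List.cons_append, List.cons.injEq] at h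
      exact absurd (hA y (by simp)) (h.1 ▸ hx')
    | cons y' A' =>
      simp only [List.cons_append, List.cons.injEq] at h
      obtain ⟨h1, h2⟩ := ih (fun z hz => hA z (by simp [hz])) (fun z hz => hA' z (by simp [hz])) h.2
      exact ⟨by rw [h.1, h1], h2⟩

theorem append_inj_of_forall {α : Type*} {p : α → Prop} {A A' D D' : List α}
    (hA : ∀ y ∈ A, p y) (hA' : ∀ y ∈ A', p y) (hD : ∀ y ∈ D, ¬ p y) (hD' : ∀ y ∈ D', ¬ p y)
    (h : A ++ D = A' ++ D') : A = A' ∧ D = D' := by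
  classical
  have h1 := congrArg (List.filter (fun x => decide (p x))) h
  rw [List.filter_append, List.filter_append,
    List.filter_eq_self.2 fun a ha => decide_eq_true (hA a ha),
    List.filter_eq_self.2 fun a ha => decide_eq_true (hA' a ha),
    List.filter_eq_nil_iff.2 fun a ha => by simpa using hD a ha,
    List.filter_eq_nil_iff.2 fun a ha => by simpa using hD' a ha,
    List.append_nil, List.append_nil] at h1
  subst h1
  exact ⟨rfl, List.append_cancel_left h⟩

/-- A predicate inherited by predecessors cuts a sorted list into a prefix and a suffix. It
separates the rows that stay above a block from those below it, and from the block itself. -/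
theorem exists_append_of_pairwise {α : Type*} {s : α → α → Prop} {p : α → Prop} {W : List α}
    (hW : W.Pairwise s) (hp : ∀ x y, s x y → p y → p x) :
    ∃ T N, W = T ++ N ∧ (∀ x ∈ T, p x) ∧ ∀ x ∈ N, ¬ p x := by
  induction hW with
  | nil => exact ⟨[], [], rfl, by simp, by simp⟩
  | @cons w W h1 _ ih =>
    by_cases hw : p w
    · obtain ⟨T, N, rfl, h2, h3⟩ := ih
      exact ⟨w :: T, N, rfl, by simpa [hw] using h2, h3⟩
    · exact ⟨[], w :: W, rfl, by simp, by
        simpa [hw] using fun x hx hpx => hw (hp w x (h1 x hx) hpx)⟩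

/-- The leading rows of a parking function, down to the first unmarked row `u`. -/
structure Lead (V : List Row) (T : List Row) (u : Row) (R : List Row) : Prop where
  eq : V = T ++ u :: R
  mark : ∀ x ∈ T, x.mark = true
  last : u.mark = false

theorem Valid.exists_lead {M : Row → Row → Prop} {V : List Row} (hV : Valid M V) (h : V ≠ []) :
    ∃ T u R, Lead V T u R := by
  induction V with
  | nil => exact absurd rfl h
  | cons y V ih =>
    cases hy : y.mark with
    | false => exact ⟨[], y, V, rfl, by simp, hy⟩
    | true =>
      cases V with
      | nil => simp [(linked_singleton.1 hV).2.2] at hy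
      | cons x V =>
        obtain ⟨T, u, R, h1, h2, h3⟩ := ih hV.tail (by simp)
        exact ⟨y :: T, u, R, by rw [h1]; rfl, by simpa [hy] using h2, h3⟩

theorem Valid.pairwise_lead {V : List Row} (hV : Valid Row.IsVal V) {T R : List Row} {u : Row}
    (h : Lead V T u R) : (T ++ [u]).Pairwise Row.IsVal := by
  obtain ⟨rfl, h2, h3⟩ := h
  rw [← List.isChain_iff_pairwise]
  induction T with
  | nil => simp
  | cons y T ih =>
    have h4 := ih (fun x hx => h2 x (by simp [hx])) hV.tail
    have h5 := h2 y (by simp)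
    cases T with
    | nil => simpa using (linked_cons_cons.1 hV).1.2 h5
    | cons z T => exact List.isChain_cons_cons.2 ⟨(linked_cons_cons.1 hV).1.2 h5, h4⟩

theorem valid_append_cons {A D : List Row} {x : Row} (hA : (A ++ [x]).Pairwise Row.IsVal)
    (hD : Valid Row.IsVal (x :: D)) : Valid Row.IsVal (A ++ x :: D) :=
  linked_append_cons.2 ⟨hA.isChain.imp fun _ _ h => ⟨h.step, fun _ => h⟩, hD⟩

theorem attackers_append (x : Row) (A B : List Row) :
    attackers x (A ++ B) = attackers x A + attackers x B := by
  simp [attackers]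

@[simp] theorem attackers_cons (x y : Row) (A : List Row) :
    attackers x (y :: A) = (if y.mark = false ∧ y.Att x then 1 else 0) + attackers x A := rfl

theorem uDinv_append {A : List Row} (hA : ∀ x ∈ A, x.mark = true) (D : List Row) :
    uDinv (A ++ D) = (A.map fun x => attackers x D).sum + uDinv D := by
  induction A with
  | nil => simp
  | cons y A ih =>
    have h1 : attackers y A = 0 := attackers_eq_zero.2 fun x hx h => by
      simp [hA x (by simp [hx])] at h
    rw [List.cons_append, uDinv_cons, ih fun x hx => hA x (by simp [hx]), attackers_append, h1]
    simp [add_assoc]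

theorem marks_eq_length {A : List Row} (hA : ∀ x ∈ A, x.mark = true) : marks A = A.length := by
  rw [marks, List.countP_eq_length]
  exact hA

/-- The window is the half-open interval from `u` up to `u` raised by one diagonal, in the order of
`IsVal`. -/
theorem window_iff {x u : Row} : Window u.area u.label x.pos ↔ ¬ x.IsVal u ∧ x.Step u := by
  simp only [Window, Row.pos, Row.IsVal, Row.Step]
  omega

theorem Row.att_iff {v x : Row} : v.Att x ↔ x.IsVal v ∧ v.Step x := by
  simp only [Row.Att, Row.IsVal, Row.Step]
  omega

theorem Row.Step.of_not_isVal {v u x : Row} (h : v.Step u) (h' : ¬ x.IsVal u) : v.Step x := by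
  simp only [Row.IsVal, Row.Step] at *
  omega

theorem Row.not_isVal_trans {x y z : Row} (h : ¬ x.IsVal y) (h' : ¬ y.IsVal z) :
    ¬ x.IsVal z := by
  simp only [Row.IsVal] at *
  omega

theorem Row.isVal_of_step {v x y : Row} (h : ¬ v.Step x) (h' : v.Step y) : x.IsVal y := by
  simp only [Row.IsVal, Row.Step] at *
  omega

/-! ### The area of the construction -/

theorem desc_eq_sum (w : List ℕ) :
    desc w = ∑ i ∈ range (w.length - 1), if w.getD (i + 1) 0 < w.getD i 0 then 1 else 0 := by
  induction w with
  | nil => rfl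
  | cons x w ih =>
    cases w with
    | nil => rfl
    | cons y w =>
      rw [desc_cons_cons, ih]
      simp only [List.length_cons, Nat.add_sub_cancel]
      rw [Finset.sum_range_succ', add_comm]
      simp

/-- A new first letter shifts every descent position by one and may create a descent at position 1;
both effects are counted by `desc (x :: w)`. -/
theorem wordMaj_cons (x : ℕ) (w : List ℕ) : wordMaj (x :: w) = wordMaj w + desc (x :: w) := by
  cases w with
  | nil => rfl
  | cons y w =>
    rw [desc_cons_cons, desc_eq_sum, wordMaj, wordMaj, List.length_cons, List.length_cons,
      Nat.add_sub_cancel, Nat.add_sub_cancel, Finset.sum_range_succ', add_comm _ (Finset.sum _ _),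
      ← add_assoc, ← Finset.sum_add_distrib]
    congr 1
    · refine Finset.sum_congr rfl fun i _ => ?_
      simp only [List.getD_cons_succ]
      split_ifs <;> rfl

/-- If areas go up by one exactly at descents, the area of each row is the number of descents from
its letter on. Summing these over all letters counts a descent at position `i` exactly `i` times. -/
theorem wordMaj_append {S : List Row} {u : Row} {w : List ℕ} (hu : u.area = desc (u.label :: w))
    (hS : (S ++ [u]).IsChain fun y x => y.area = x.area + if x.label < y.label then 1 else 0) :
    wordMaj (S.map Row.label ++ u.label :: w) = listArea S + wordMaj (u.label :: w) ∧
      ∀ y ∈ (S ++ [u]).head?, y.area = desc (S.map Row.label ++ u.label :: w) := by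
  induction S with
  | nil => simpa using hu
  | cons z S ih =>
    obtain ⟨h1, h2⟩ := ih hS.tail
    have h3 : z.area = desc (z.label :: (S.map Row.label ++ u.label :: w)) := by
      cases S with
      | nil =>
        have h4 := (List.isChain_cons_cons.1 hS).1
        rw [List.map_nil, List.nil_append, desc_cons_cons, ← hu, h4, add_comm]
      | cons y S =>
        have h4 := (List.isChain_cons_cons.1 hS).1
        have h5 := h2 y rfl
        rw [List.map_cons, List.cons_append, desc_cons_cons, ← List.cons_append, ← List.map_cons,
          ← h5, h4, add_comm]
    refine ⟨?_, ?_⟩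
    · rw [List.map_cons, List.cons_append, wordMaj_cons, h1, ← h3, listArea_cons]
      omega
    · intro y hy
      obtain rfl : z = y := by simpa using hy
      exact h3

theorem listArea_append (A B : List Row) : listArea (A ++ B) = listArea A + listArea B := by
  simp [listArea]

theorem listArea_reverse (A : List Row) : listArea A.reverse = listArea A := by
  simp [listArea, List.sum_reverse]

/-- In a window the labels at most `l` lie on diagonal `a` and the larger ones on `a + 1`, so the
reversed block changes area exactly at its descent. -/
theorem isChain_area {a l : ℕ} {L : List Row} (h : L.Pairwise Row.IsVal)
    (hw : ∀ x ∈ L, Window a l x.pos) :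
    L.reverse.IsChain fun y x => y.area = x.area + if x.label < y.label then 1 else 0 := by
  rw [List.isChain_reverse]
  refine List.Pairwise.isChain (List.Pairwise.imp_of_mem ?_ h)
  intro x y hx hy hxy
  have h1 := hw x hx
  have h2 := hw y hy
  simp only [Row.IsVal, Window, Row.pos] at *
  split_ifs <;> omega

/-- The properties of the parking functions constructed by `Build`. -/
structure Built (π : List (Finset ℕ)) (V T : List Row) (u : Row) (R : List Row) : Prop
    extends Lead V T u R where
  valid : Valid Row.IsVal V
  max : ∀ x ∈ V, x.mark = false → ¬ u.IsVal x
  uDinv_eq : uDinv V = marks V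
  labels : (V.map Row.label : Multiset ℕ) = (π.map Finset.val).sum
  length_eq : V.length = marks V + π.length
  word : ∃ w, miniword π = u.label :: w ∧ u.area = desc (u.label :: w)
  area : listArea V = wordMaj (miniword π)

/-- The new unmarked row `v` attacks each row of `N` and none of `T`, and nothing in `D` attacks the
new rows. Hence as many pairs are created as marks. -/
theorem uDinv_insert {T N D : List Row} {v : Row} (hT : ∀ x ∈ T, x.mark = true)
    (hN : ∀ x ∈ N, x.mark = true) (hv : v.mark = false) (hTv : ∀ x ∈ T, ¬ v.Att x)
    (hNv : ∀ x ∈ N, v.Att x) (hND : ∀ x ∈ N, attackers x D = 0) (hvD : attackers v D = 0) :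
    uDinv (T ++ (N ++ v :: D)) = uDinv (T ++ D) + N.length := by
  have h1 : T.map (fun x => attackers x (N ++ v :: D)) = T.map fun x => attackers x D := by
    refine List.map_congr_left fun x hx => ?_
    rw [attackers_append, attackers_cons, attackers_eq_zero.2, if_neg, zero_add, zero_add]
    · exact fun h => hTv x hx h.2
    · intro y hy h
      simp [hN y hy] at h
  have h2 : N.map (fun x => attackers x (v :: D)) = N.map fun _ => 1 := by
    refine List.map_congr_left fun x hx => ?_
    rw [attackers_cons, hND x hx, if_pos ⟨hv, hNv x hx⟩]
  rw [uDinv_append hT, uDinv_append hN, uDinv_cons, uDinv_append hT, hvD, h1, h2]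
  simp only [List.map_const', List.sum_replicate, smul_eq_mul, mul_one]
  omega

theorem sup_window {B : Finset ℕ} {N : List Row} {v : Row} (h : IsBlock 0 (B.sup id) B N v)
    {x : Row} (hx : x ∈ N ++ [v]) : x.area = 0 ∧ x.label ∈ B := by
  have h1 := List.mem_map_of_mem (f := Row.pos) hx
  rw [h.map_pos, mem_blockPos] at h1
  have h2 : x.label ≤ B.sup id := Finset.le_sup (f := id) h1.1
  have h3 := h1.2
  simp only [Window, Row.pos] at h3
  exact ⟨by omega, h1.1⟩

theorem built_base {B : Finset ℕ} {N : List Row} {v : Row} (h0 : 0 ∉ B)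
    (hb : IsBlock 0 (B.sup id) B N v) : Built [B] (N ++ [v]) N v [] := by
  have hv := sup_window hb (x := v) (by simp)
  have hmarks : marks (N ++ [v]) = N.length := by
    rw [marks_append, marks_eq_length hb.mark]
    simp [hb.last]
  have hchain := isChain_area hb.pairwise fun x hx => hb.window hx
  rw [List.reverse_append, List.reverse_singleton, List.singleton_append] at hchain
  have hword : miniword [B] = ((N ++ [v]).map Row.label).reverse := by
    rw [hb.map_label, reverse_map_snd_blockPos, miniword, miniword]
    rw [Finset.filter_false_of_mem, Finset.filter_true_of_mem, Finset.sort_empty, List.nil_append]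
    · exact fun x hx => Finset.le_sup (f := id) hx
    · exact fun x hx => not_lt.2 (Finset.le_sup (f := id) hx)
  have hzero : ∀ x ∈ N ++ [v], x.area = 0 := fun x hx => (sup_window hb hx).1
  have hareas : listArea (N ++ [v]) = 0 := by
    rw [listArea, List.sum_eq_zero_iff]
    simp only [List.mem_map]
    rintro _ ⟨x, hx, rfl⟩
    exact hzero x hx
  -- With all areas 0, the chain condition forbids descents.
  have hsorted : ∀ (L : List Row), L.IsChain (fun y x => y.area = x.area +
      if x.label < y.label then 1 else 0) → (∀ x ∈ L, x.area = 0) →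
      desc (L.map Row.label) = 0 ∧ wordMaj (L.map Row.label) = 0 := by
    intro L hL h
    induction L with
    | nil => exact ⟨rfl, rfl⟩
    | cons y L ih =>
      obtain ⟨h1, h2⟩ := ih hL.tail fun x hx => h x (by simp [hx])
      have h3 : desc ((y :: L).map Row.label) = 0 := by
        cases L with
        | nil => rfl
        | cons z L =>
          have h4 := (List.isChain_cons_cons.1 hL).1
          rw [h y (by simp), h z (by simp)] at h4
          rw [List.map_cons, List.map_cons, desc_cons_cons]
          rw [List.map_cons] at h1
          omega
      refine ⟨h3, ?_⟩
      rw [List.map_cons] at h3 ⊢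
      rw [wordMaj_cons, h2, h3]
  have hdesc := hsorted (v :: N.reverse) hchain (by simpa [or_comm] using hzero)
  have hrev : ((N ++ [v]).map Row.label).reverse = (v :: N.reverse).map Row.label := by simp
  refine ⟨⟨rfl, hb.mark, hb.last⟩, ?_, ?_, ?_, ?_, ?_, ?_, ?_⟩
  · exact valid_append_cons hb.pairwise
      (linked_singleton.2 ⟨hv.1, fun h => h0 (h ▸ hv.2), hb.last⟩)
  · intro x hx hxm
    rcases List.mem_append.1 hx with hx | hx
    · simp [hb.mark x hx] at hxm
    · obtain rfl : x = v := by simpa using hx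
      simp [Row.IsVal]
  · have := uDinv_insert (T := []) (N := N) (D := []) (v := v) (by simp) hb.mark hb.last (by simp)
      (fun x hx => ?_) (fun _ _ => rfl) rfl
    · rw [hmarks]
      simpa using this
    · rw [Row.att_iff]
      have h1 := hzero x (by simp [hx])
      have h2 := hb.val_last hx
      refine ⟨h2, ?_⟩
      simp only [Row.IsVal, Row.Step] at *
      omega
  · rw [hb.coe_labels]
    simp
  · rw [hmarks]
    simp
  · refine ⟨(N.map Row.label).reverse, ?_, ?_⟩
    · rw [hword]
      simp
    · rw [hv.1]
      simpa using hdesc.1.symm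
  · rw [hareas, hword, hrev, hdesc.2]

/-- Rows of `T` precede `u`, and the new rows do not, so `T ++ N ++ [v]` is sorted. No unmarked row
is preceded by `u`, hence none below attacks the new rows. Each row of `N` is attacked by `v`
because the window spans one diagonal. -/
theorem built_step {π : List (Finset ℕ)} {B : Finset ℕ} {T T' N R : List Row} {u v : Row}
    (h : Built π (T ++ (T' ++ u :: R)) (T ++ T') u R) (hb : IsBlock u.area u.label B N v)
    (hTv : ∀ x ∈ T, ¬ v.Step x) (hTv' : ∀ x ∈ T', v.Step x) :
    Built (B :: π) (T ++ (N ++ v :: (T' ++ u :: R))) (T ++ N) v (T' ++ u :: R) := by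
  have hlead := h.valid.pairwise_lead h.toLead
  have hT : ∀ x ∈ T, x.mark = true := fun x hx => h.mark x (by simp [hx])
  have hwin : ∀ x ∈ N ++ [v], ¬ x.IsVal u ∧ x.Step u := fun x hx => window_iff.1 (hb.window hx)
  have hTu : ∀ x ∈ T, x.IsVal u := fun x hx =>
    (List.pairwise_append.1 hlead).2.2 x (by simp [hx]) u (by simp)
  have hvu := hwin v (by simp)
  have hmax : ∀ x ∈ N ++ [v], ∀ y ∈ T' ++ u :: R, y.mark = false → ¬ x.IsVal y :=
    fun x hx y hy hym => Row.not_isVal_trans (hwin x hx).1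
      (h.max y (List.mem_append_right _ hy) hym)
  have hatt : ∀ x ∈ N ++ [v], attackers x (T' ++ u :: R) = 0 := fun x hx =>
    attackers_eq_zero.2 fun y hy hym hyx => hmax x hx y hy hym (Row.att_iff.1 hyx).1
  have hTN : ∀ x ∈ T, ∀ y ∈ N ++ [v], x.IsVal y := by
    intro x hx y hy
    have h1 := hTu x hx
    have h2 := (hwin y hy).1
    simp only [Row.IsVal] at *
    omega
  have hmarks : marks (T ++ (N ++ v :: (T' ++ u :: R))) =
      marks (T ++ (T' ++ u :: R)) + N.length := by
    simp only [marks_append, marks_cons, marks_eq_length hb.mark, hb.last]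
    simp
    omega
  obtain ⟨w, hw, huw⟩ := h.word
  have hchain : (N.reverse ++ [u]).IsChain
      (fun y x => y.area = x.area + if x.label < y.label then 1 else 0) ∧
      ((v :: N.reverse) ++ [u]).IsChain
      (fun y x => y.area = x.area + if x.label < y.label then 1 else 0) := by
    have h1 := isChain_area hb.pairwise fun x hx => hb.window hx
    have h2 : ((N ++ [v]).reverse ++ [u]).IsChain
        (fun y x => y.area = x.area + if x.label < y.label then 1 else 0) := by
      refine h1.append (by simp) ?_
      intro y hy x hx
      obtain rfl : u = x := by simpa using hx
      have h3 := hb.window (x := y) (List.mem_reverse.1 (List.mem_of_getLast? hy))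
      simp only [Window, Row.pos] at h3
      split_ifs <;> omega
    have h3 : ((v :: N.reverse) ++ [u]).IsChain
        (fun y x => y.area = x.area + if x.label < y.label then 1 else 0) := by
      simpa using h2
    exact ⟨h3.tail, h3⟩
  have hmini : miniword (B :: π) = (v :: N.reverse).map Row.label ++ u.label :: w := by
    rw [miniword, hw]
    simp only
    rw [← reverse_map_snd_blockPos u.area, ← hb.map_label]
    simp
  obtain ⟨hmaj, hdesc⟩ := wordMaj_append huw hchain.2
  refine ⟨⟨by simp, ?_, hb.last⟩, ?_, ?_, ?_, ?_, ?_, ?_, ?_⟩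
  · intro x hx
    rcases List.mem_append.1 hx with hx | hx
    · exact hT x hx
    · exact hb.mark x hx
  · rw [← List.append_assoc]
    refine valid_append_cons ?_ (linked_cons.2 ⟨?_, by simp, h.valid.right_of_append⟩)
    · rw [List.append_assoc, List.pairwise_append]
      exact ⟨(List.pairwise_append.1 (List.pairwise_append.1 hlead).1).1, hb.pairwise, hTN⟩
    · intro x hx
      refine ⟨?_, by simp [hb.last]⟩
      cases T' with
      | nil =>
        obtain rfl : u = x := by simpa using hx
        exact hvu.2
      | cons z T' =>
        obtain rfl : z = x := by simpa using hx
        exact hTv' z (by simp)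
  · intro x hx hxm
    rcases List.mem_append.1 hx with hx | hx
    · simp [hT x hx] at hxm
    · rcases List.mem_append.1 hx with hx | hx
      · simp [hb.mark x hx] at hxm
      · rcases List.mem_cons.1 hx with rfl | hx
        · simp [Row.IsVal]
        · exact hmax v (by simp) x hx hxm
  · rw [hmarks, ← h.uDinv_eq]
    refine uDinv_insert hT hb.mark hb.last (fun x hx hxv => hTv x hx (Row.att_iff.1 hxv).2)
      (fun x hx => ?_) (fun x hx => hatt x (by simp [hx])) (hatt v (by simp))
    exact Row.att_iff.2 ⟨hb.val_last hx, hvu.2.of_not_isVal (hwin x (by simp [hx])).1⟩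
  · rw [List.map_cons, List.sum_cons, ← h.labels, ← hb.coe_labels]
    simp only [List.map_append, List.map_cons, ← Multiset.coe_add, ← Multiset.cons_coe,
      List.map_nil, Multiset.coe_nil]
    simp only [← Multiset.singleton_add]
    simp only [add_zero]
    abel
  · rw [hmarks]
    have := h.length_eq
    simp only [List.length_append, List.length_cons] at this ⊢
    omega
  · refine ⟨N.reverse.map Row.label ++ u.label :: w, by rw [hmini]; rfl, ?_⟩
    have := hdesc v rfl
    rw [this]
    rfl
  · rw [hmini, hmaj, ← hw, ← h.area]
    simp only [listArea_append, listArea_cons, listArea_reverse]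
    omega

theorem Build.built {π : List (Finset ℕ)} {V : List Row} (h : Build π V) (hπ : π ≠ []) :
    ∃ T u R, Built π V T u R := by
  induction h with
  | nil => exact absurd rfl hπ
  | base h0 hb => exact ⟨_, _, _, built_base h0 hb⟩
  | @step π B T T' N R u v h hT hT' hu hb hTv hTv' ih =>
    -- The empty partition builds only the empty list, which contains no `u`.
    have hπ : π ≠ [] := by
      rintro rfl
      generalize hV : T ++ (T' ++ u :: R) = V at h
      cases h
      simp at hV
    obtain ⟨T₀, u₀, R₀, h0⟩ := ih hπ
    obtain ⟨rfl, rfl, rfl⟩ := append_cons_inj (p := fun x : Row => x.mark = true) (A := T ++ T')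
      (x := u) (x' := u₀)
      (by simpa [or_imp, forall_and] using ⟨hT, hT'⟩) h0.mark (by simp [hu]) (by simp [h0.last])
      (by rw [← h0.eq, List.append_assoc])
    exact ⟨_, _, _, built_step h0 hb hTv hTv'⟩

theorem Build.built_of_eq {π : List (Finset ℕ)} {T R : List Row} {u : Row}
    (h : Build π (T ++ u :: R)) (hT : ∀ x ∈ T, x.mark = true) (hu : u.mark = false) :
    Built π (T ++ u :: R) T u R := by
  have hπ : π ≠ [] := by
    rintro rfl
    generalize hV : T ++ u :: R = V at h
    cases h
    simp at hV
  obtain ⟨T₀, u₀, R₀, h0⟩ := h.built hπ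
  obtain ⟨rfl, rfl, rfl⟩ := append_cons_inj (p := fun x : Row => x.mark = true)
    hT h0.mark (by simp [hu]) (by simp [h0.last]) h0.eq
  exact h0

/-! ### The bijection for `minimaj` -/

theorem Build.length_eq {π : List (Finset ℕ)} {V : List Row} (h : Build π V) :
    V.length = marks V + π.length := by
  by_cases hπ : π = []
  · subst hπ
    cases h
    rfl
  · obtain ⟨T, u, R, h⟩ := h.built hπ
    exact h.length_eq

theorem Build.valid {π : List (Finset ℕ)} {V : List Row} (h : Build π V) :
    Valid Row.IsVal V := by
  by_cases hπ : π = []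
  · subst hπ
    cases h
    exact linked_nil
  · obtain ⟨T, u, R, h⟩ := h.built hπ
    exact h.valid

theorem Build.uDinv_eq {π : List (Finset ℕ)} {V : List Row} (h : Build π V) :
    uDinv V = marks V := by
  by_cases hπ : π = []
  · subst hπ
    cases h
    rfl
  · obtain ⟨T, u, R, h⟩ := h.built hπ
    exact h.uDinv_eq

theorem Build.labels {π : List (Finset ℕ)} {V : List Row} (h : Build π V) :
    (V.map Row.label : Multiset ℕ) = (π.map Finset.val).sum := by
  by_cases hπ : π = []
  · subst hπ
    cases h
    rfl
  · obtain ⟨T, u, R, h⟩ := h.built hπ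
    exact h.labels

theorem Build.area {π : List (Finset ℕ)} {V : List Row} (h : Build π V) :
    listArea V = minimaj π := by
  by_cases hπ : π = []
  · subst hπ
    cases h
    rfl
  · obtain ⟨T, u, R, h⟩ := h.built hπ
    exact h.area

/-! ### `Build` as a one-to-one relation -/

theorem IsBlock.nonempty {a l : ℕ} {B : Finset ℕ} {N : List Row} {v : Row}
    (h : IsBlock a l B N v) : B.Nonempty := by
  rw [Finset.nonempty_iff_ne_empty]
  rintro rfl
  have := congrArg Multiset.card h.coe_labels
  simp at this

theorem Build.nonempty {π : List (Finset ℕ)} {V : List Row} (h : Build π V) :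
    ∀ B ∈ π, B.Nonempty := by
  induction h with
  | nil => simp
  | base h0 hb => simpa using hb.nonempty
  | step h hT hT' hu hb hTv hTv' ih => simpa [hb.nonempty] using ih

theorem Build.zero_notMem {π : List (Finset ℕ)} {V : List Row} (h : Build π V) :
    ∀ B, π.getLast? = some B → 0 ∉ B := by
  induction h with
  | nil => simp
  | base h0 hb => simpa using h0
  | @step π B T T' N R u v h hT hT' hu hb hTv hTv' ih =>
    cases π with
    | nil =>
      generalize hV : T ++ (T' ++ u :: R) = V at h
      cases h
      simp at hV
    | cons C π => simpa [List.getLast?_cons_cons] using ih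

theorem exists_build {π : List (Finset ℕ)} (hπ : ∀ B ∈ π, B.Nonempty)
    (h0 : ∀ B, π.getLast? = some B → 0 ∉ B) : ∃ V, Build π V := by
  induction π with
  | nil => exact ⟨[], .nil⟩
  | cons B π ih =>
    have hB := hπ B (by simp)
    cases π with
    | nil =>
      obtain ⟨N, v, hb⟩ := exists_isBlock 0 (B.sup id) hB
      exact ⟨_, .base (h0 B rfl) hb⟩
    | cons C π =>
      obtain ⟨V, hV⟩ := ih (fun D hD => hπ D (by simp_all))
        fun D hD => h0 D (by rwa [List.getLast?_cons_cons])
      obtain ⟨W, u, R, h⟩ := hV.built (by simp)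
      obtain ⟨N, v, hb⟩ := exists_isBlock u.area u.label hB
      have hW := (List.pairwise_append.1 (h.valid.pairwise_lead h.toLead)).1
      obtain ⟨T, T', rfl, hT, hT'⟩ := exists_append_of_pairwise (p := fun x => ¬ v.Step x) hW
        fun x y hxy hy hx => hy (by
          simp only [Row.IsVal, Row.Step] at *
          omega)
      rw [h.eq, List.append_assoc] at hV
      exact ⟨_, hV.step (fun x hx => h.mark x (by simp [hx])) (fun x hx => h.mark x (by simp [hx]))
        h.last hb hT (by simpa using hT')⟩

/-- The previous rows determine `u`, hence the window and the block rows, and the cut between `T`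
and `T'` is decided by `v.Step`. -/
theorem Build.right_unique {π : List (Finset ℕ)} {V V' : List Row} (h : Build π V)
    (h' : Build π V') : V = V' := by
  induction h generalizing V' with
  | nil => cases h'; rfl
  | base h0 hb =>
    cases h' with
    | base h0' hb' =>
      obtain ⟨rfl, rfl⟩ := hb.unique hb'
      rfl
    | @step _ _ T T' N R u v h =>
      generalize hV : T ++ (T' ++ u :: R) = V at h
      cases h
      simp at hV
  | @step π B T T' N R u v h hT hT' hu hb hTv hTv' ih =>
    generalize hπ : B :: π = ρ at h'
    cases h' with
    | nil => simp at hπ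
    | base h0' hb' =>
      obtain ⟨rfl, rfl⟩ : B = _ ∧ π = [] := by simpa using hπ
      generalize hV : T ++ (T' ++ u :: R) = V at h
      cases h
      simp at hV
    | @step π₂ B₂ T₂ T₂' N₂ R₂ u₂ v₂ h₂ hT₂ hT₂' hu₂ hb₂ hTv₂ hTv₂' =>
      obtain ⟨rfl, rfl⟩ : B = B₂ ∧ π = π₂ := by simpa using hπ
      have h1 := ih h₂
      rw [← List.append_assoc, ← List.append_assoc] at h1
      obtain ⟨h2, rfl, rfl⟩ := append_cons_inj (p := fun x : Row => x.mark = true)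
        (x := u) (x' := u₂) (by simpa [or_imp, forall_and] using ⟨hT, hT'⟩)
        (by simpa [or_imp, forall_and] using ⟨hT₂, hT₂'⟩) (by simp [hu]) (by simp [hu₂]) h1
      obtain ⟨rfl, rfl⟩ := hb.unique hb₂
      obtain ⟨rfl, rfl⟩ := append_inj_of_forall hTv hTv₂ (by simpa using hTv')
        (by simpa using hTv₂') h2
      rfl

/-- The two topmost unmarked rows are `v` and `u`. Among the marked rows above `v`, those preceding
`u` form `T` and the others form `N`, so the last insertion can be undone. -/
theorem Build.left_unique {π π' : List (Finset ℕ)} {V : List Row} (h : Build π V)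
    (h' : Build π' V) : π = π' := by
  induction h generalizing π' with
  | nil =>
    have := h'.length_eq
    simpa [eq_comm] using this
  | @base B N v h0 hb =>
    have hlen := (Build.base h0 hb).length_eq.symm.trans h'.length_eq
    generalize hV : N ++ [v] = V at h'
    cases h' with
    | nil => simp at hV
    | @base B' N' v' h0' hb' =>
      obtain ⟨rfl, rfl⟩ : N = N' ∧ v = v' := by
        obtain ⟨h1, h2⟩ := List.append_inj' hV rfl
        exact ⟨h1, by simpa using h2⟩
      rw [show B = B' from Finset.val_injective (hb.coe_labels.symm.trans hb'.coe_labels)]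
    | @step π₂ B₂ T₂ T₂' N₂ R₂ u₂ v₂ h₂ =>
      have : π₂ = [] := by
        rw [hV] at hlen
        simpa [eq_comm] using hlen
      subst this
      generalize hV : T₂ ++ (T₂' ++ u₂ :: R₂) = V at h₂
      cases h₂
      simp at hV
  | @step π B T T' N R u v h hT hT' hu hb hTv hTv' ih =>
    have hlen := (h.step hT hT' hu hb hTv hTv').length_eq.symm.trans h'.length_eq
    generalize hV : T ++ (N ++ v :: (T' ++ u :: R)) = V at h' hlen
    cases h' with
    | nil => simp at hV
    | @base B' N' v' h0' hb' =>
      have : π = [] := by simpa using hlen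
      subst this
      generalize hV : T ++ (T' ++ u :: R) = V at h
      cases h
      simp at hV
    | @step π₂ B₂ T₂ T₂' N₂ R₂ u₂ v₂ h₂ hT₂ hT₂' hu₂ hb₂ hTv₂ hTv₂' =>
      rw [← List.append_assoc, ← List.append_assoc] at hV
      obtain ⟨h1, rfl, h2⟩ := append_cons_inj (p := fun x : Row => x.mark = true)
        (x := v) (x' := v₂) (by simpa [or_imp, forall_and] using ⟨hT, hb.mark⟩)
        (by simpa [or_imp, forall_and] using ⟨hT₂, hb₂.mark⟩) (by simp [hb.last])
        (by simp [hb₂.last]) hV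
      obtain ⟨rfl, rfl, rfl⟩ := append_cons_inj (p := fun x : Row => x.mark = true)
        (x := u) (x' := u₂) hT' hT₂' (by simp [hu]) (by simp [hu₂]) h2
      have key : ∀ {π : List (Finset ℕ)} {T : List Row}, Build π (T ++ (T' ++ u :: R)) →
          (∀ x ∈ T, x.mark = true) → ∀ x ∈ T, x.IsVal u := by
        intro π T h hT x hx
        rw [← List.append_assoc] at h
        have hm : ∀ x ∈ T ++ T', x.mark = true := by simpa [or_imp, forall_and] using ⟨hT, hT'⟩
        have h3 := h.built_of_eq hm hu
        exact (List.pairwise_append.1 (h3.valid.pairwise_lead h3.toLead)).2.2 x (by simp [hx]) u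
          (by simp)
      obtain ⟨rfl, rfl⟩ := append_inj_of_forall (p := fun x : Row => x.IsVal u) (key h hT)
        (key h₂ hT₂) (fun x hx => (window_iff.1 (hb.window (by simp [hx]))).1)
        (fun x hx => (window_iff.1 (hb₂.window (by simp [hx]))).1) h1
      rw [ih h₂, hb.eq_of_rows hb₂]

/-! ### Every tight parking function is built -/

theorem Valid.isBlock_base {W : List Row} {v : Row} (hV : Valid Row.IsVal (W ++ [v]))
    (hW : ∀ x ∈ W, x.mark = true) :
    0 ∉ ((W ++ [v]).map Row.label).toFinset ∧
      IsBlock 0 (((W ++ [v]).map Row.label).toFinset.sup id)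
        ((W ++ [v]).map Row.label).toFinset W v := by
  have hv : v.Bottom := linked_singleton.1 hV.right_of_append
  have hpair := hV.pairwise_lead ⟨rfl, hW, hv.2.2⟩
  have hWv : ∀ x ∈ W, x.IsVal v := fun x hx =>
    (List.pairwise_append.1 hpair).2.2 x hx v (by simp)
  have hv0 := hv.1
  have hv1 := hv.2.1
  constructor
  · simp only [List.mem_toFinset, List.mem_map, List.mem_append, List.mem_singleton]
    rintro ⟨x, hx | rfl, h⟩
    · have := hWv x hx
      simp only [Row.IsVal] at this
      omega
    · exact hv1 h
  · refine isBlock_of_pairwise hpair (fun x hx => Or.inl ⟨?_, ?_⟩) hW hv.2.2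
    · rcases List.mem_append.1 hx with hx | hx
      · have := hWv x hx
        simp only [Row.IsVal, Row.pos] at *
        omega
      · obtain rfl : x = v := by simpa using hx
        exact hv0
    · exact Finset.le_sup (f := id) (List.mem_toFinset.2 (List.mem_map_of_mem hx))

theorem length_le_sum_attackers {W D : List Row} (hD : Valid Row.IsVal D)
    (h : ∀ x ∈ W, ∃ y ∈ D, x.IsVal y) : W.length ≤ (W.map fun x => attackers x D).sum := by
  have := List.sum_le_sum (l := W) (f := fun _ => 1) (g := fun x => attackers x D)
    fun x hx => hD.attackers_pos (h x hx)
  simpa using this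

theorem exists_build_eq {V : List Row} (hV : Valid Row.IsVal V) (hd : uDinv V ≤ marks V) :
    ∃ π, Build π V := by
  induction hN : V.length using Nat.strong_induction_on generalizing V with
  | _ k ih =>
    subst hN
    rcases eq_or_ne V [] with rfl | hne
    · exact ⟨[], .nil⟩
    obtain ⟨W, v, D, hlead⟩ := hV.exists_lead hne
    have hpair := hV.pairwise_lead hlead
    obtain ⟨rfl, hW, hv⟩ := hlead
    rcases eq_or_ne D [] with rfl | hDne
    · obtain ⟨h1, h2⟩ := hV.isBlock_base hW
      exact ⟨_, .base h1 h2⟩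
    have hvD : Valid Row.IsVal (v :: D) := hV.right_of_append
    have hD : Valid Row.IsVal D := hvD.tail
    have hWv : ∀ x ∈ W, x.IsVal v := fun x hx =>
      (List.pairwise_append.1 hpair).2.2 x hx v (by simp)
    have hDle := hD.marks_le_uDinv
    have hWle := length_le_sum_attackers hvD fun x hx => ⟨v, by simp, hWv x hx⟩
    rw [uDinv_append hW, uDinv_cons, marks_append, marks_cons, marks_eq_length hW, hv] at hd
    simp only [Bool.false_eq_true, if_false, add_zero] at hd
    -- The bounds for `W` and for `D` already exhaust the marks, so nothing can attack `v`.
    have hvatt : attackers v D = 0 := by omega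
    have hmax : ∀ x ∈ D, ¬ v.IsVal x := by
      intro x hx h
      have := hD.attackers_pos ⟨x, hx, h⟩
      omega
    obtain ⟨T', u, R, hlead'⟩ := hD.exists_lead hDne
    have hpair' := hD.pairwise_lead hlead'
    obtain ⟨hDeq, hT', hu⟩ := hlead'
    have hhead : ∀ x ∈ D.head?, v.Step x := fun x hx => ((linked_cons.1 hvD).1 x hx).1
    have hT'v : ∀ x ∈ T' ++ [u], v.Step x := by
      intro x hx
      cases h : T' ++ [u] with
      | nil => simp at h
      | cons z L =>
        have hz : v.Step z := by
          refine hhead z ?_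
          rw [hDeq, show T' ++ u :: R = (T' ++ [u]) ++ R by simp, h]
          rfl
        rw [h] at hpair' hx
        rcases List.mem_cons.1 hx with rfl | hx
        · exact hz
        · have := (List.pairwise_cons.1 hpair').1 x hx
          simp only [Row.IsVal, Row.Step] at *
          omega
    -- The rows preceding `u` were there before the insertion; the others belong to the block of
    -- `v`.
    obtain ⟨T, N, rfl, hT, hN⟩ := exists_append_of_pairwise (p := fun x : Row => x.IsVal u)
      (List.pairwise_append.1 hpair).1 fun x y hxy hy => hxy.trans hy
    have huD : u ∈ D := by simp [hDeq]
    have hTm : ∀ x ∈ T, x.mark = true := fun x hx => hW x (by simp [hx])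
    have hNm : ∀ x ∈ N, x.mark = true := fun x hx => hW x (by simp [hx])
    have hTle := length_le_sum_attackers hD (W := T) fun x hx => ⟨u, huD, hT x hx⟩
    have hNle := length_le_sum_attackers hvD (W := N) fun x hx => ⟨v, by simp, hWv x (by simp [hx])⟩
    have hsum : (T.map fun x => attackers x (v :: D)).sum =
        (T.map fun x => if v.mark = false ∧ v.Att x then 1 else 0).sum +
          (T.map fun x => attackers x D).sum := by
      rw [← List.sum_map_add]
      rfl
    rw [List.map_append, List.sum_append, List.length_append, hsum] at hd
    -- A row of `T` precedes `u`, so it already has an unmarked attacker in `D`; by tightness `v`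
    -- cannot attack it as well.
    have hTv : ∀ x ∈ T, ¬ v.Step x := by
      have h1 : (T.map fun x => if v.mark = false ∧ v.Att x then 1 else 0).sum = 0 := by omega
      intro x hx hvx
      rw [List.sum_eq_zero_iff] at h1
      have h2 := h1 _ (List.mem_map_of_mem hx)
      rw [if_pos ⟨hv, Row.att_iff.2 ⟨hWv x (by simp [hx]), hvx⟩⟩] at h2
      exact one_ne_zero h2
    -- With the block removed, `T` rests directly on `D`: `v.Step` fails on `T` and holds on the
    -- rows down to `u`, so the former precede the latter.
    have hV₀ : Valid Row.IsVal (T ++ D) := by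
      rw [hDeq] at hD ⊢
      rw [← List.append_assoc]
      refine valid_append_cons ?_ hD.right_of_append
      rw [List.append_assoc, List.pairwise_append]
      exact ⟨(List.pairwise_append.1 (List.pairwise_append.1 hpair).1).1, hpair',
        fun x hx y hy => Row.isVal_of_step (hTv x hx) (hT'v y hy)⟩
    obtain ⟨π, hπ⟩ := ih (T ++ D).length
      (by simp only [List.length_append, List.length_cons]; omega) hV₀
      (by rw [uDinv_append hTm, marks_append, marks_eq_length hTm]; omega) rfl
    -- Rows of `N` precede `v`, and `v.Step u`, so they precede `u` raised by one diagonal; none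
    -- precedes `u`. They therefore lie in the window of `u`.
    have hb : IsBlock u.area u.label ((N ++ [v]).map Row.label).toFinset N v := by
      refine isBlock_of_pairwise ?_ (fun x hx => window_iff.2 ?_) hNm hv
      · rw [List.append_assoc] at hpair
        exact (List.pairwise_append.1 hpair).2.1
      · have hvu : v.Step u := hT'v u (by simp)
        rcases List.mem_append.1 hx with hx | hx
        · refine ⟨hN x hx, ?_⟩
          have := hWv x (by simp [hx])
          simp only [Row.IsVal, Row.Step] at *
          omega
        · obtain rfl : x = v := by simpa using hx
          exact ⟨hmax u huD, hvu⟩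
    subst hDeq
    refine ⟨((N ++ [v]).map Row.label).toFinset :: π, ?_⟩
    rw [List.append_assoc]
    exact hπ.step hTm hT' hu hb hTv fun x hx => hT'v x (by simp [hx])

theorem exists_bijOn_minimaj (r : ℕ) {ℓ : ℕ} (β : Fin ℓ → ℕ) (m : ℤ) :
    ∃ Φ : List (Finset ℕ) → List Row,
      Set.BijOn Φ (OP r β m) {V ∈ markedSet Row.IsVal r β m | uDinv V - marks V = 0} ∧
        ∀ π ∈ OP r β m, listArea (Φ π) = minimaj π := by
  classical
  have hex : ∀ π ∈ OP r β m, ∃ V, Build π V := fun π hπ => exists_build hπ.1 hπ.2.2.1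
  choose! Φ hΦ using hex
  refine ⟨Φ, ⟨fun π hπ => ?_, fun π hπ π' hπ' h => ?_, ?_⟩, fun π hπ => (hΦ π hπ).area⟩
  · have h := hΦ π hπ
    refine ⟨⟨h.valid, h.labels.trans hπ.2.1, ?_⟩, by simp [h.uDinv_eq]⟩
    have h1 := h.length_eq
    have h2 := hπ.2.2.2
    omega
  · exact (hΦ π hπ).left_unique (h ▸ hΦ π' hπ')
  · rintro V ⟨⟨h1, h2, h3⟩, h4⟩
    obtain ⟨π, h⟩ := exists_build_eq h1 (by omega)
    have hπ : π ∈ OP r β m := by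
      refine ⟨h.nonempty, h.labels.symm.trans h2, h.zero_notMem, ?_⟩
      have := h.length_eq
      omega
    exact ⟨π, hπ, (hΦ π hπ).right_unique h⟩

end ExtendedDelta
/-- The coefficients of `x^β` in the two sides are (images in `ℚ(q,t)` of) polynomials in `q, t`;
these are unique, and their values at `t = 0` and at `q = 0` (with `t` renamed `q`) are the
generating polynomials of the four statistics. -/
theorem mainTheorem5 (n r : ℕ) (k : ℤ) (ℓ : ℕ) (β : Fin ℓ → ℕ) (hβ : ∑ i, β i = n) :
    (∃ P : MvPolynomial (Fin 2) ℤ,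
      algebraMap (MvPolynomial (Fin 2) ℤ) ExtendedDelta.Kqt P =
          MvPowerSeries.coeff (ExtendedDelta.monoExp β) (ExtendedDelta.riseSide r n k) ∧
        MvPolynomial.aeval ![(Polynomial.X : ℤ[X]), 0] P =
          ExtendedDelta.genPoly r β (k + r + 1) ExtendedDelta.opDinv ∧
        MvPolynomial.aeval ![0, (Polynomial.X : ℤ[X])] P =
          ExtendedDelta.genPoly r β (k + r + 1) ExtendedDelta.opMaj) ∧
    (∃ P : MvPolynomial (Fin 2) ℤ,
      algebraMap (MvPolynomial (Fin 2) ℤ) ExtendedDelta.Kqt P =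
          MvPowerSeries.coeff (ExtendedDelta.monoExp β) (ExtendedDelta.valSide r n k) ∧
        MvPolynomial.aeval ![(Polynomial.X : ℤ[X]), 0] P =
          ExtendedDelta.genPoly r β (k + r + 1) ExtendedDelta.inv ∧
        MvPolynomial.aeval ![0, (Polynomial.X : ℤ[X])] P =
          ExtendedDelta.genPoly r β (k + r + 1) ExtendedDelta.minimaj) := by
  obtain ⟨Φ₁, h₁, h₁'⟩ := ExtendedDelta.exists_bijOn_opDinv r β (k + r + 1)
  obtain ⟨Φ₂, h₂, h₂'⟩ := ExtendedDelta.exists_bijOn_opMaj r β (k + r + 1)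
  obtain ⟨Φ₃, h₃, h₃'⟩ := ExtendedDelta.exists_bijOn_inv r β (k + r + 1)
  obtain ⟨Φ₄, h₄, h₄'⟩ := ExtendedDelta.exists_bijOn_minimaj r β (k + r + 1)
  refine ⟨⟨_, (ExtendedDelta.coeff_riseSide n r k (ExtendedDelta.monoExp β)).symm, ?_, ?_⟩,
    ⟨_, (ExtendedDelta.coeff_valSide n r k (ExtendedDelta.monoExp β)).symm, ?_, ?_⟩⟩
  · rw [ExtendedDelta.aeval_X_zero_markedPoly]
    exact ExtendedDelta.sum_marked_eq_genPoly
      (f := ExtendedDelta.uArea) (g := ExtendedDelta.listDinv) hβ ExtendedDelta.mem_Rise h₁ h₁'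
  · rw [ExtendedDelta.aeval_zero_X_markedPoly]
    exact ExtendedDelta.sum_marked_eq_genPoly
      (f := ExtendedDelta.listDinv) (g := ExtendedDelta.uArea) hβ ExtendedDelta.mem_Rise h₂ h₂'
  · rw [ExtendedDelta.aeval_X_zero_markedPoly]
    exact ExtendedDelta.sum_marked_eq_genPoly
      (f := ExtendedDelta.listArea) (g := fun V => ExtendedDelta.uDinv V - ExtendedDelta.marks V)
      hβ ExtendedDelta.mem_Val h₃ h₃'
  · rw [ExtendedDelta.aeval_zero_X_markedPoly]
    exact ExtendedDelta.sum_marked_eq_genPoly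
      (f := fun V => ExtendedDelta.uDinv V - ExtendedDelta.marks V) (g := ExtendedDelta.listArea)
      hβ ExtendedDelta.mem_Val h₄ h₄'
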